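/- Let $\mathcal K$ be a finite dimensional complex Hilbert space, $\mathcal O$ the $*$-algebra of all linear maps on $\mathcal K$, and $(\mathcal O,\tau^t,\omega)$ a finite quantum dynamical system: $t\mapsto\tau^t$, $t\in\mathbb R$, is a continuous one-parameter group of $*$-automorphisms of $\mathcal O$ and $\omega$ is a faithful state, i.e. a strictly positive operator with $\mathrm{tr}\,\omega=1$. Write $\rho(A)=\mathrm{tr}(\rho A)$ for a density matrix $\rho$ and $A\in\mathcal O$, $\omega_t=\tau^{-t}(\omega)$, $\ell_{\omega_t|\omega}=\log\omega_t-\log\omega$. For faithful states $\rho,\nu$ let $S(\rho|\nu)=\mathrm{tr}(\rho(\log\nu-\log\rho))$ be the relative entropy (with this sign, $S\le 0$), let $\varsigma_\rho^{z}(A)=e^{iz\log\rho}Ae^{-iz\log\rho}$ for $z\in\mathbb C$, and let $\langle A|B\rangle_\rho=\int_0^1\rho(A^*\varsigma_\rho^{-iu}(B))\,du$ be the standard correlation. For $t,\alpha\in\mathbb R$ define $$e_{p,t}(\alpha)=\log\mathrm{tr}\Big[\big(\omega^{(1-\alpha)/p}\,\omega_t^{2\alpha/p}\,\omega^{(1-\alpha)/p}\big)^{p/2}\Big]\quad(1\le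 p<\infty),\qquad e_{\infty,t}(\alpha)=\log\mathrm{tr}\big(e^{(1-\alpha)\log\omega+\alpha\log\omega_t}\big).$$ Then for every $t\in\mathbb R$: 1. For every $\alpha\in\mathbb R$ the function $[1,\infty]\ni p\mapsto e_{p,t}(\alpha)$ is continuous (including at $p=\infty$) and monotonically decreasing (non-increasing). 2. For every $p\in[1,\infty]$ the function $\mathbb R\ni\alpha\mapsto e_{p,t}(\alpha)$ is real-analytic and convex, $e_{p,t}(0)=e_{p,t}(1)=0$, $e_{p,t}(\alpha)\le 0$ for $\alpha\in[0,1]$, and $e_{p,t}(\alpha)\ge 0$ for $\alpha\notin[0,1]$. 3. $e_{p,t}(\alpha)=e_{p,-t}(1-\alpha)$ for all $p\in[1,\infty]$ and $\alpha\in\mathbb R$. 4. For every $p\in[1,\infty]$, $\partial_\alpha e_{p,t}(\alpha)|_{\alpha=0}=\omega(\ell_{\omega_t|\omega})=S(\omega|\omega_t)$ and $\partial_\alpha e_{p,t}(\alpha)|_{\alpha=1}=\omega_t(\ell_{\omega_t|\omega})=-S(\omega_t|\omega)$. 5. $\partial_\alpha^2 e_{\infty,t}(\alpha)|_{\alpha=0}=\langle\ell_{\omega_t|\omega}|\ell_{\omega_t|\omega}\rangle_\omega-\omega(\ell_{\omega_t|\omega})^2$.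 6. $\partial_\alpha^2 e_{2,t}(\alpha)|_{\alpha=0}=\omega(\ell_{\omega_t|\omega}^2)-\omega(\ell_{\omega_t|\omega})^2$. 7. If the system is time-reversal invariant, i.e. there is an anti-linear $*$-automorphism $\Theta$ of $\mathcal O$ with $\Theta\circ\Theta=\mathrm{id}$, $\tau^t\circ\Theta=\Theta\circ\tau^{-t}$ for all $t\in\mathbb R$, and $\omega(\Theta(A))=\omega(A^*)$ for all $A\in\mathcal O$, then the finite-time quantum Evans–Searles symmetry $e_{p,t}(\alpha)=e_{p,t}(1-\alpha)$ holds for all $p\in[1,\infty]$ and $\alpha\in\mathbb R$. -/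

import Mathlib

open scoped ENNReal Topology

namespace FiniteQuantum

noncomputable section

/-- The algebra `𝒪` of all linear maps of a finite dimensional Hilbert space `K`, with its operator
norm, its adjoint `star` and its functional calculus. -/
abbrev Obs (K : Type*) [NormedAddCommGroup K] [InnerProductSpace ℂ K] : Type _ := K →L[ℂ] K

section

variable {K : Type*} [NormedAddCommGroup K] [InnerProductSpace ℂ K]

/-- The trace of an observable. -/
def tr (A : Obs K) : ℂ := LinearMap.trace ℂ K (A : K →ₗ[ℂ] K)

/-- The expectation `ρ(A) = tr(ρ A)` of the observable `A` in the density matrix `ρ`. -/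
def expect (ρ A : Obs K) : ℂ := tr (ρ * A)

/-- A faithful state: a density matrix with trivial kernel. -/
structure IsFaithfulState (ρ : Obs K) : Prop where
  isPositive : ρ.IsPositive
  tr_eq_one : tr ρ = 1
  ker_eq_bot : LinearMap.ker (ρ : K →ₗ[ℂ] K) = ⊥

end

section

variable {K : Type*} [NormedAddCommGroup K] [InnerProductSpace ℂ K] [CompleteSpace K]

/-- The relative entropy in the (non-positive) sign convention
`S(ρ|ν) = tr(ρ (log ν - log ρ))` if `Ran ρ ⊆ Ran ν`, and `-∞` otherwise. Since `Real.log 0 = 0`,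
the trace formula obeys the convention `0 log 0 = 0`. -/
def relEntropy (ρ ν : Obs K) : EReal :=
  open scoped Classical in
  if LinearMap.range (ρ : K →ₗ[ℂ] K) ≤ LinearMap.range (ν : K →ₗ[ℂ] K) then
    (((tr (ρ * (CFC.log ν - CFC.log ρ))).re : ℝ) : EReal)
  else ⊥

/-- The relative Hamiltonian `ℓ_{ρ|ν} = log ρ - log ν` of two faithful states. -/
def relHamiltonian (ρ ν : Obs K) : Obs K := CFC.log ρ - CFC.log ν

/-- The modular dynamics `ς_ρ^z(A) = e^{i z log ρ} A e^{-i z log ρ}` at complex time `z`. -/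
def modularFlow (ρ : Obs K) (z : ℂ) (A : Obs K) : Obs K :=
  NormedSpace.exp ((Complex.I * z) • CFC.log ρ) * A *
    NormedSpace.exp (-((Complex.I * z) • CFC.log ρ))

/-- The standard correlation `⟨A|B⟩_ρ = ∫₀¹ ρ(A* ς_ρ^{-iu}(B)) du`. -/
def stdCorrelation (ρ A B : Obs K) : ℂ :=
  ∫ u in (0 : ℝ)..1, expect ρ (star A * modularFlow ρ (-(Complex.I * (u : ℂ))) B)

end

/-- A finite quantum dynamical system `(𝒪, τ^t, ω)`: a continuous one-parameter group `τ` of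
`*`-automorphisms of the algebra of all linear maps of `K`, and a faithful state `ω`. -/
structure QuantumDynamicalSystem (K : Type*) [NormedAddCommGroup K] [InnerProductSpace ℂ K]
    [CompleteSpace K] where
  /-- the dynamics -/
  τ : ℝ → (Obs K ≃⋆ₐ[ℂ] Obs K)
  /-- the reference state -/
  ω : Obs K
  group_law : ∀ t s A, τ t (τ s A) = τ (t + s) A
  tendsto_zero : ∀ A, Filter.Tendsto (fun t => τ t A) (𝓝 0) (𝓝 A)
  faithful : IsFaithfulState ω

namespace QuantumDynamicalSystem

variable {K : Type*} [NormedAddCommGroup K] [InnerProductSpace ℂ K] [CompleteSpace K]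

/-- The evolved state `ω_t = τ^{-t}(ω)`, i.e. the density matrix of `ω ∘ τ^t`. -/
def state (Q : QuantumDynamicalSystem K) (t : ℝ) : Obs K := Q.τ (-t) Q.ω

/-- The relative Hamiltonian `ℓ_{ω_t|ω}`. -/
def ell (Q : QuantumDynamicalSystem K) (t : ℝ) : Obs K := relHamiltonian (Q.state t) Q.ω

/-- The entropic pressure functional `e_{p,t}(α)`, for `p ∈ [1,∞]`; the powers and logarithms are
those of the functional calculus. -/
def pressure (Q : QuantumDynamicalSystem K) (p : ℝ≥0∞) (t α : ℝ) : ℝ :=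
  if p = ∞ then
    Real.log (tr (NormedSpace.exp
      ((1 - α) • CFC.log Q.ω + α • CFC.log (Q.state t)))).re
  else
    Real.log (tr ((Q.ω ^ ((1 - α) / p.toReal) * Q.state t ^ (2 * α / p.toReal) *
      Q.ω ^ ((1 - α) / p.toReal)) ^ (p.toReal / 2))).re

/-- `Θ` is a time reversal of `(𝒪, τ^t)`: an anti-linear multiplicative `*`-preserving involution
(hence an anti-linear `*`-automorphism) with `τ^t ∘ Θ = Θ ∘ τ^{-t}`. -/
structure IsTimeReversal (Q : QuantumDynamicalSystem K) (Θ : Obs K →ₗ⋆[ℂ] Obs K) : Prop where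
  map_mul : ∀ A B, Θ (A * B) = Θ A * Θ B
  map_star : ∀ A, Θ (star A) = star (Θ A)
  involutive : ∀ A, Θ (Θ A) = A
  reverses : ∀ t A, Q.τ t (Θ A) = Θ (Q.τ (-t) A)

/-- The system is time-reversal invariant: it has a time reversal `Θ` with `ω(Θ(A)) = ω(A*)`. -/
def IsTRI (Q : QuantumDynamicalSystem K) : Prop :=
  ∃ Θ : Obs K →ₗ⋆[ℂ] Obs K, Q.IsTimeReversal Θ ∧ ∀ A, expect Q.ω (Θ A) = expect Q.ω (star A)

end QuantumDynamicalSystem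

end

end FiniteQuantum

namespace FiniteQuantum

open NormedSpace

/-! ### Traces, and Cauchy–Schwarz against unitaries. -/

section Trace

variable {K : Type*} [NormedAddCommGroup K] [InnerProductSpace ℂ K]

/-! Put H = log ω, G = log ω_t and s = 1/p. The dynamics commutes with exp and log and preserves the
trace, so `pressure_eq` turns the pressure into the logarithm of `partitionFn H G s α`. This
involves only two self-adjoint operators with tr e^H = tr e^G = 1: for s > 0 it is tr |M|^{1/s} with
M = e^{s(1-α)H} e^{sαG}, and for s = 0 it is tr e^{(1-α)H+αG}.

Both inequalities come from one complex interpolation, `schatten_interpolation`, which combines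
Hadamard's three lines theorem with the duality between Schatten norms. Interpolating from the
identity at s = 0 gives the Araki-Lieb-Thirring inequality, that is, monotonicity in p. Keeping s
fixed and moving α gives convexity, and the signs follow from convexity and the zeros at 0 and 1.

The point p = ∞ is reached by the Lie product formula, in the form that log(e^{uG} e^{2uH} e^{uG})
has derivative 2(H + G) at u = 0 (`hasDerivAt_log_sandwich`). Hence `partitionFn` is continuous in
s, and monotonicity and convexity pass to s = 0. Analyticity in α rests on the power series of the
logarithm (`analyticAt_log`).

The derivatives use Duhamel's formula. Under the trace cyclicity collapses it at first order; at
second order for p = ∞ the Duhamel integral survives and is the standard correlation.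

The symmetries are invariances of `partitionFn`: M and M* have equal Schatten norms, which swaps H
and G, and trace preserving real *-homomorphisms (`partitionFn_map`) cover both the dynamics and the
time reversal. -/

lemma tr_mul_comm (A B : Obs K) : tr (A * B) = tr (B * A) :=
  LinearMap.trace_mul_comm ℂ (A : K →ₗ[ℂ] K) (B : K →ₗ[ℂ] K)

lemma tr_add (A B : Obs K) : tr (A + B) = tr A + tr B :=
  map_add (LinearMap.trace ℂ K) (A : K →ₗ[ℂ] K) (B : K →ₗ[ℂ] K)

lemma tr_sub (A B : Obs K) : tr (A - B) = tr A - tr B :=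
  map_sub (LinearMap.trace ℂ K) (A : K →ₗ[ℂ] K) (B : K →ₗ[ℂ] K)

lemma tr_smul (c : ℂ) (A : Obs K) : tr (c • A) = c * tr A :=
  map_smul (LinearMap.trace ℂ K) c (A : K →ₗ[ℂ] K)

lemma tr_real_smul (c : ℝ) (A : Obs K) : tr (c • A) = c * tr A := by
  rw [← Complex.coe_smul, tr_smul]

variable [FiniteDimensional ℂ K]

/-- The trace as a continuous linear functional. -/
noncomputable def trCLM : Obs K →L[ℂ] ℂ :=
  LinearMap.toContinuousLinearMap
    { toFun := tr, map_add' := tr_add, map_smul' := tr_smul }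

@[simp] lemma trCLM_apply (A : Obs K) : trCLM A = tr A := rfl

lemma continuous_tr : Continuous (tr : Obs K → ℂ) := (trCLM (K := K)).continuous

lemma tr_eq_sum (A : Obs K) :
    tr A = ∑ i, inner ℂ (stdOrthonormalBasis ℂ K i) (A (stdOrthonormalBasis ℂ K i)) :=
  LinearMap.trace_eq_sum_inner (A : K →ₗ[ℂ] K) (stdOrthonormalBasis ℂ K)

variable [CompleteSpace K]

lemma tr_star (A : Obs K) : tr (star A) = star (tr A) := by
  simp only [tr_eq_sum, star_sum]
  refine Finset.sum_congr rfl fun i _ => ?_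
  rw [ContinuousLinearMap.star_eq_adjoint, ContinuousLinearMap.adjoint_inner_right]
  exact (inner_conj_symm _ _).symm

lemma tr_mul_star_mul (X U : Obs K) : tr (U * (star X * X)) =
    ∑ i, inner ℂ (X (star U (stdOrthonormalBasis ℂ K i))) (X (stdOrthonormalBasis ℂ K i)) := by
  rw [tr_eq_sum]
  refine Finset.sum_congr rfl fun i _ => ?_
  simp only [ContinuousLinearMap.star_eq_adjoint, mul_apply_eq_comp]
  rw [← ContinuousLinearMap.adjoint_inner_right, ContinuousLinearMap.adjoint_inner_left]

lemma tr_star_mul_self (X : Obs K) :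
    tr (star X * X) = ((∑ i, ‖X (stdOrthonormalBasis ℂ K i)‖ ^ 2 : ℝ) : ℂ) := by
  have := tr_mul_star_mul X 1
  rw [one_mul] at this
  rw [this]
  push_cast
  refine Finset.sum_congr rfl fun i _ => ?_
  rw [star_one, one_apply_eq_self, inner_self_eq_norm_sq_to_K]
  rfl

/-- The trace is a sum of inner products of X U* e_i with X e_i. Cauchy–Schwarz and the
arithmetic-geometric mean bound it by two sums of squares, both equal to tr(X*X) by cyclicity. -/
lemma norm_tr_unitary_mul_le {U : Obs K} (hU : U ∈ unitary (Obs K)) (X : Obs K) :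
    ‖tr (U * (star X * X))‖ ≤ (tr (star X * X)).re := by
  have h1 : (tr (star (X * star U) * (X * star U))) = tr (star X * X) := by
    rw [star_mul, star_star, mul_assoc, tr_mul_comm, ← mul_assoc, mul_assoc, mul_assoc,
      (Unitary.mem_iff.mp hU).1, mul_one]
  have h2 := congrArg Complex.re (tr_star_mul_self (X * star U))
  have h3 := congrArg Complex.re (tr_star_mul_self X)
  rw [h1, Complex.ofReal_re] at h2
  rw [Complex.ofReal_re] at h3
  rw [tr_mul_star_mul]
  calc _ ≤ ∑ i, ‖inner ℂ (X (star U (stdOrthonormalBasis ℂ K i)))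
          (X (stdOrthonormalBasis ℂ K i))‖ := norm_sum_le _ _
    _ ≤ ∑ i, (‖(X * star U) (stdOrthonormalBasis ℂ K i)‖ ^ 2 / 2 +
          ‖X (stdOrthonormalBasis ℂ K i)‖ ^ 2 / 2) := by
        refine Finset.sum_le_sum fun i _ => (norm_inner_le_norm _ _).trans ?_
        rw [mul_apply_eq_comp]
        nlinarith [sq_nonneg (‖X (star U (stdOrthonormalBasis ℂ K i))‖ -
          ‖X (stdOrthonormalBasis ℂ K i)‖)]
    _ = _ := by
        rw [Finset.sum_add_distrib, ← Finset.sum_div, ← Finset.sum_div, ← h2, ← h3]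
        ring

end Trace

/-! ### Exponentials of self-adjoint operators at real and complex times. -/

section Exp

variable {K : Type*} [NormedAddCommGroup K] [InnerProductSpace ℂ K] [CompleteSpace K]

lemma exp_add_of_commute' {X Y : Obs K} (h : Commute X Y) : exp (X + Y) = exp X * exp Y := by
  let _ : NormedAlgebra ℚ (Obs K) := NormedAlgebra.restrictScalars ℚ ℂ _
  exact exp_add_of_commute h

lemma exp_smul_mul_exp_smul (z w : ℂ) (H : Obs K) :
    exp (z • H) * exp (w • H) = exp ((z + w) • H) := by
  rw [add_smul, exp_add_of_commute' (((Commute.refl H).smul_left z).smul_right w)]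

lemma exp_real_smul_mul_exp_smul (x y : ℝ) (H : Obs K) :
    exp (x • H) * exp (y • H) = exp ((x + y) • H) := by
  rw [add_smul, exp_add_of_commute' (((Commute.refl H).smul_left x).smul_right y)]

lemma exp_mul_exp_neg (H : Obs K) : exp H * exp (-H) = 1 := by
  rw [← exp_add_of_commute' (Commute.refl H).neg_right, add_neg_cancel, exp_zero]

lemma exp_neg_mul_exp (H : Obs K) : exp (-H) * exp H = 1 := by
  rw [← exp_add_of_commute' (Commute.refl H).neg_left, neg_add_cancel, exp_zero]

lemma isUnit_exp' (H : Obs K) : IsUnit (exp H) :=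
  ⟨⟨exp H, exp (-H), exp_mul_exp_neg H, exp_neg_mul_exp H⟩, rfl⟩

lemma isSelfAdjoint_exp {H : Obs K} (hH : IsSelfAdjoint H) : IsSelfAdjoint (exp H) := by
  rw [isSelfAdjoint_iff, star_exp, hH.star_eq]

lemma isSelfAdjoint_real_smul {H : Obs K} (hH : IsSelfAdjoint H) (x : ℝ) :
    IsSelfAdjoint (x • H) := by
  rw [isSelfAdjoint_iff, star_smul, hH.star_eq, star_trivial]

lemma exp_imag_smul_mem_unitary {H : Obs K} (hH : IsSelfAdjoint H) {z : ℂ} (hz : z.re = 0) :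
    exp (z • H) ∈ unitary (Obs K) := by
  have : star (exp (z • H)) = exp (-(z • H)) := by
    rw [star_exp, star_smul, hH.star_eq, ← neg_smul]
    congr 2
    apply Complex.ext <;> simp [hz]
  rw [Unitary.mem_iff, this]
  exact ⟨exp_neg_mul_exp _, exp_mul_exp_neg _⟩

/-- Splitting of a complex power into a unitary and a real power. -/
lemma exp_smul_eq_imag_mul_real (z : ℂ) (H : Obs K) :
    exp (z • H) = exp ((Complex.I * z.im) • H) * exp (z.re • H) := by
  rw [← Complex.coe_smul z.re H, exp_smul_mul_exp_smul]
  congr 2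
  rw [add_comm, mul_comm Complex.I, Complex.re_add_im]

lemma exp_smul_eq_real_mul_imag (z : ℂ) (H : Obs K) :
    exp (z • H) = exp (z.re • H) * exp ((Complex.I * z.im) • H) := by
  rw [← Complex.coe_smul z.re H, exp_smul_mul_exp_smul]
  congr 2
  rw [mul_comm Complex.I, Complex.re_add_im]

lemma exp_eq_star_mul_self {S : Obs K} (hS : IsSelfAdjoint S) :
    exp S = star (exp ((1 / 2 : ℝ) • S)) * exp ((1 / 2 : ℝ) • S) := by
  rw [(isSelfAdjoint_exp (isSelfAdjoint_real_smul hS _)).star_eq, exp_real_smul_mul_exp_smul]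
  norm_num

lemma isStrictlyPositive_exp {S : Obs K} (hS : IsSelfAdjoint S) : IsStrictlyPositive (exp S) :=
  (isUnit_exp' S).isStrictlyPositive hS.exp_nonneg

/-- The imaginary part of z contributes only a unitary factor, so compactness of the range of real
parts suffices. The three lines theorem needs this boundedness on the strip. -/
lemma exists_norm_exp_smul_le [Nontrivial K] {H : Obs K} (hH : IsSelfAdjoint H) (c : ℝ) :
    ∃ C, ∀ z : ℂ, |z.re| ≤ c → ‖exp (z • H)‖ ≤ C := by
  have hcont : Continuous fun x : ℝ => exp (x • H) :=
    continuous_iff_continuousAt.mpr fun x => (hasDerivAt_exp_smul_const H x).continuousAt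
  obtain ⟨C, hC⟩ := (isCompact_Icc (a := -c) (b := c)).exists_bound_of_continuousOn
    hcont.continuousOn
  refine ⟨C, fun z hz => ?_⟩
  rw [exp_smul_eq_imag_mul_real]
  refine (norm_mul_le _ _).trans ?_
  rw [CStarRing.norm_of_mem_unitary (exp_imag_smul_mem_unitary hH (by simp)), one_mul]
  exact hC _ (abs_le.mp hz)

lemma differentiable_exp_smul (H : Obs K) : Differentiable ℂ fun z : ℂ => exp (z • H) :=
  fun z => (hasDerivAt_exp_smul_const H z).differentiableAt

end Exp

/-! ### The positive number tr e^S. -/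

section TrExp

variable {K : Type*} [NormedAddCommGroup K] [InnerProductSpace ℂ K] [CompleteSpace K]
  [FiniteDimensional ℂ K]

/-- The real number `tr e^S`. -/
noncomputable def trExp (S : Obs K) : ℝ := (tr (exp S)).re

lemma tr_exp_eq {S : Obs K} (hS : IsSelfAdjoint S) : tr (exp S) = (trExp S : ℂ) := by
  rw [trExp, exp_eq_star_mul_self hS, tr_star_mul_self, Complex.ofReal_re]

lemma trExp_pos [Nontrivial K] {S : Obs K} (hS : IsSelfAdjoint S) : 0 < trExp S := by
  have hdim : 0 < Module.finrank ℂ K := Module.finrank_pos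
  rw [trExp, exp_eq_star_mul_self hS, tr_star_mul_self, Complex.ofReal_re]
  refine Finset.sum_pos (fun i _ => ?_) ⟨⟨0, hdim⟩, Finset.mem_univ _⟩
  refine pow_pos (norm_pos_iff.mpr fun h => ?_) 2
  have h1 := DFunLike.congr_fun (exp_neg_mul_exp ((1 / 2 : ℝ) • S)) (stdOrthonormalBasis ℂ K i)
  rw [mul_apply_eq_comp, h, map_zero, one_apply_eq_self] at h1
  exact (stdOrthonormalBasis ℂ K).orthonormal.ne_zero i h1.symm

lemma norm_tr_unitary_mul_exp_le {U S : Obs K} (hU : U ∈ unitary (Obs K))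
    (hS : IsSelfAdjoint S) : ‖tr (U * exp S)‖ ≤ trExp S := by
  rw [trExp, exp_eq_star_mul_self hS]
  exact norm_tr_unitary_mul_le hU _

end TrExp

/-! ### Hölder duality and complex interpolation of Schatten norms. -/

section Interpolation

variable {K : Type*} [NormedAddCommGroup K] [InnerProductSpace ℂ K] [CompleteSpace K]

lemma isStrictlyPositive_star_mul_self {M : Obs K} (hM : IsUnit M) :
    IsStrictlyPositive (star M * M) :=
  (hM.star.mul hM).isStrictlyPositive (star_mul_self_nonneg M)

lemma exp_log_star_mul_self {M : Obs K} (hM : IsUnit M) :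
    exp (CFC.log (star M * M)) = star M * M :=
  CFC.exp_log _ (isStrictlyPositive_star_mul_self hM)

/-- Polar decomposition with |M| written as an exponential, so that powers of |M| extend to complex
exponents. -/
lemma exists_polar {M : Obs K} (hM : IsUnit M) :
    ∃ W ∈ unitary (Obs K), M = W * exp ((1 / 2 : ℝ) • CFC.log (star M * M)) := by
  set T := CFC.log (star M * M) with hT
  have hTs : IsSelfAdjoint T := IsSelfAdjoint.log
  have hinv : exp (-((1 / 2 : ℝ) • T)) * exp ((1 / 2 : ℝ) • T) = 1 := exp_neg_mul_exp _
  have hsa : star (exp (-((1 / 2 : ℝ) • T))) = exp (-((1 / 2 : ℝ) • T)) :=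
    (isSelfAdjoint_exp (isSelfAdjoint_real_smul hTs _).neg).star_eq
  refine ⟨M * exp (-((1 / 2 : ℝ) • T)), ?_, by rw [mul_assoc, hinv, mul_one]⟩
  have h1 : star (M * exp (-((1 / 2 : ℝ) • T))) * (M * exp (-((1 / 2 : ℝ) • T))) = 1 := by
    rw [star_mul, hsa, mul_assoc, ← mul_assoc (star M), ← exp_log_star_mul_self hM, ← hT,
      ← neg_smul]
    nth_rewrite 2 [← one_smul ℝ T]
    rw [exp_real_smul_mul_exp_smul, exp_real_smul_mul_exp_smul]
    norm_num
  have hu : IsUnit (M * exp (-((1 / 2 : ℝ) • T))) := hM.mul (isUnit_exp' _)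
  rw [Unitary.mem_iff]
  refine ⟨h1, ?_⟩
  obtain ⟨v, hv⟩ := hu.exists_right_inv
  rwa [left_inv_eq_right_inv h1 hv]

lemma exists_norm_exp_affine_le [Nontrivial K] {H : Obs K} (hH : IsSelfAdjoint H) (a b : ℝ) :
    ∃ C, ∀ z : ℂ, 0 ≤ z.re → z.re ≤ 1 → ‖exp ((a + b * z) • H)‖ ≤ C := by
  obtain ⟨C, hC⟩ := exists_norm_exp_smul_le hH (|a| + |b|)
  refine ⟨C, fun z h0 h1 => hC _ ?_⟩
  simp only [Complex.add_re, Complex.ofReal_re, Complex.mul_re, Complex.ofReal_im, zero_mul,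
    sub_zero]
  refine (abs_add_le _ _).trans ?_
  rw [abs_mul, abs_of_nonneg h0]
  have := abs_nonneg b
  nlinarith

variable [FiniteDimensional ℂ K]

/-- The `p`-th power of the Schatten `p`-norm of `M`, in terms of `s = 1 / p`. -/
noncomputable def schatten (s : ℝ) (M : Obs K) : ℝ :=
  trExp ((1 / (2 * s)) • CFC.log (star M * M))

lemma schatten_pos [Nontrivial K] (s : ℝ) (M : Obs K) : 0 < schatten s M :=
  trExp_pos (isSelfAdjoint_real_smul IsSelfAdjoint.log _)

/-- The bound of the pairing with the `q`-th roots of density matrices, `1 / q = 1 - s`,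
that Hölder's inequality gives for an operator whose Schatten norm of exponent `1 / s`
is at most `C`. -/
def HolderBound (s : ℝ) (M : Obs K) (C : ℝ) : Prop :=
  ∀ V₁ ∈ unitary (Obs K), ∀ V₂ ∈ unitary (Obs K), ∀ S : Obs K, IsSelfAdjoint S →
    ‖tr (V₁ * M * V₂ * exp ((1 - s) • S))‖ ≤ C * trExp S ^ (1 - s)

lemma holderBound_one_of_unitary {U : Obs K} (hU : U ∈ unitary (Obs K)) :
    HolderBound 0 U 1 := by
  intro V₁ h₁ V₂ h₂ S hS
  rw [sub_zero, one_smul, Real.rpow_one, one_mul]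
  exact norm_tr_unitary_mul_exp_le (mul_mem (mul_mem h₁ hU) h₂) hS

lemma norm_le_of_norm_le_strip {F : ℂ → ℂ} (hF : Differentiable ℂ F) {C a b : ℝ}
    (hC : ∀ z : ℂ, 0 ≤ z.re → z.re ≤ 1 → ‖F z‖ ≤ C)
    (ha : ∀ z : ℂ, z.re = 0 → ‖F z‖ ≤ a) (hb : ∀ z : ℂ, z.re = 1 → ‖F z‖ ≤ b)
    {θ : ℝ} (h0 : 0 ≤ θ) (h1 : θ ≤ 1) : ‖F θ‖ ≤ a ^ (1 - θ) * b ^ θ := by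
  have := Complex.HadamardThreeLines.norm_le_interp_of_mem_verticalClosedStrip' (f := F)
    (z := (θ : ℂ)) (l := 0) (u := 1) zero_lt_one (by
      simp [Complex.HadamardThreeLines.verticalClosedStrip, h0, h1]) hF.diffContOnCl
    ⟨C, by
      rintro _ ⟨z, hz, rfl⟩
      exact hC z hz.1 hz.2⟩ (fun z hz => ha z hz) (fun z hz => hb z hz)
  simpa using this

lemma exists_norm_tr_le : ∃ C, ∀ A : Obs K, ‖tr A‖ ≤ C * ‖A‖ :=
  ⟨‖trCLM (K := K)‖, fun A => (trCLM (K := K)).le_opNorm A⟩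

lemma differentiable_tr_affine (U V H G S : Obs K) (a b c d e f : ℝ) :
    Differentiable ℂ fun z : ℂ => tr (U * (exp ((a + b * z) • H) * V * exp ((c + d * z) • G)) *
        exp ((e + f * z) • S)) := by
  have key : ∀ (x y : ℝ) (X : Obs K), Differentiable ℂ fun z : ℂ => exp ((x + y * z) • X) :=
    fun x y X => (differentiable_exp_smul X).comp
      ((differentiable_const _).add ((differentiable_const _).mul differentiable_id))
  exact (trCLM (K := K)).differentiable.comp
    (((differentiable_const U).mul (((key a b H).mul (differentiable_const V)).mul
      (key c d G))).mul (key e f S))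

/-- Hölder's inequality is attained. -/
lemma exists_tr_eq_schatten {s : ℝ} (hs : 0 < s) {M : Obs K} (hM : IsUnit M) :
    ∃ V ∈ unitary (Obs K), ∃ S : Obs K, IsSelfAdjoint S ∧ trExp S = schatten s M ∧
      tr (V * M * exp ((1 - s) • S)) = (schatten s M : ℂ) := by
  obtain ⟨W, hW, hMW⟩ := exists_polar hM
  have hS : IsSelfAdjoint ((1 / (2 * s)) • CFC.log (star M * M)) :=
    isSelfAdjoint_real_smul IsSelfAdjoint.log _
  -- The optimizer is e^S = |M|^{1/s}: as W* M = |M| = e^{sS}, the exponents s and 1 - s add up to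
  -- 1.
  refine ⟨star W, Unitary.star_mem hW, _, hS, rfl, ?_⟩
  rw [schatten, ← tr_exp_eq hS]
  have hWM : star W * M = exp ((1 / 2 : ℝ) • CFC.log (star M * M)) := by
    conv_lhs => rw [hMW, ← mul_assoc, (Unitary.mem_iff.mp hW).1, one_mul]
  rw [hWM, smul_smul, exp_real_smul_mul_exp_smul]
  congr 3
  field_simp
  ring

variable [Nontrivial K]

lemma exists_norm_tr_affine_le (U V : Obs K) {H G S : Obs K} (hH : IsSelfAdjoint H)
    (hG : IsSelfAdjoint G) (hS : IsSelfAdjoint S) (a b c d e f : ℝ) :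
    ∃ C, ∀ z : ℂ, 0 ≤ z.re → z.re ≤ 1 →
      ‖tr (U * (exp ((a + b * z) • H) * V * exp ((c + d * z) • G)) *
        exp ((e + f * z) • S))‖ ≤ C := by
  obtain ⟨C₀, h₀⟩ := exists_norm_tr_le (K := K)
  obtain ⟨C₁, h₁⟩ := exists_norm_exp_affine_le hH a b
  obtain ⟨C₂, h₂⟩ := exists_norm_exp_affine_le hG c d
  obtain ⟨C₃, h₃⟩ := exists_norm_exp_affine_le hS e f
  have hC₁ : 0 ≤ C₁ := (norm_nonneg _).trans (h₁ 0 (by simp) (by simp))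
  have hC₂ : 0 ≤ C₂ := (norm_nonneg _).trans (h₂ 0 (by simp) (by simp))
  refine ⟨|C₀| * (‖U‖ * (C₁ * ‖V‖ * C₂) * C₃), fun z hz hz' => (h₀ _).trans ?_⟩
  refine mul_le_mul (le_abs_self _) ?_ (norm_nonneg _) (abs_nonneg _)
  refine (norm_mul_le _ _).trans (mul_le_mul ((norm_mul_le _ _).trans ?_) (h₃ z hz hz')
    (norm_nonneg _) (by positivity))
  refine mul_le_mul_of_nonneg_left ((norm_mul_le _ _).trans ?_) (norm_nonneg _)
  refine mul_le_mul ((norm_mul_le _ _).trans ?_) (h₂ z hz hz') (norm_nonneg _) (by positivity)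
  exact mul_le_mul_of_nonneg_right (h₁ z hz hz') (norm_nonneg _)

/-- Hölder's trace inequality. -/
lemma holderBound_schatten {s : ℝ} (hs : 0 < s) (hs' : s ≤ 1) {M : Obs K} (hM : IsUnit M) :
    HolderBound s M (schatten s M ^ s) := by
  intro V₁ h₁ V₂ h₂ S hS
  obtain ⟨W, hW, hMW⟩ := exists_polar hM
  set T := (1 / (2 * s)) • CFC.log (star M * M) with hT
  have hTs : IsSelfAdjoint T := isSelfAdjoint_real_smul IsSelfAdjoint.log _
  have hMT : M = W * exp (s • T) := by
    rw [hT, smul_smul]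
    convert hMW using 4
    field_simp
  -- Three lines for z ↦ tr(V₁ W e^{zT} V₂ e^{(1-z)S}), evaluated at z = s. On each edge one
  -- exponential is unitary and the other is, up to a unitary, e^S or e^T.
  have hF := norm_le_of_norm_le_strip
    (differentiable_tr_affine (V₁ * W) V₂ T 0 S 0 1 0 0 1 (-1))
    (a := trExp S) (b := trExp T)
    (exists_norm_tr_affine_le (V₁ * W) V₂ hTs (.zero _) hS 0 1 0 0 1 (-1)).choose_spec
    ?_ ?_ hs.le hs'
  · rw [mul_comm]
    have e1 : ((0 : ℝ) + (1 : ℝ) * (s : ℂ)) • T = s • T := by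
      rw [← Complex.coe_smul]; simp
    have e2 : ((1 : ℝ) + (-1 : ℝ) * (s : ℂ)) • S = (1 - s) • S := by
      rw [← Complex.coe_smul]; congr 1; push_cast; ring
    rw [e1, e2, smul_zero, exp_zero, mul_one, mul_assoc V₁, ← mul_assoc W, ← hMT, ← mul_assoc] at hF
    exact hF
  · intro z hz
    simp only [smul_zero, exp_zero, mul_one]
    rw [exp_smul_eq_imag_mul_real _ S, ← mul_assoc]
    have : ((1 : ℝ) + (-1 : ℝ) * z : ℂ).re = 1 := by simp [hz]
    rw [this, one_smul]
    refine norm_tr_unitary_mul_exp_le (mul_mem (mul_mem (mul_mem h₁ hW) (mul_mem ?_ h₂)) ?_) hS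
    · exact exp_imag_smul_mem_unitary hTs (by simp [hz])
    · exact exp_imag_smul_mem_unitary hS (by simp)
  · intro z hz
    simp only [smul_zero, exp_zero, mul_one]
    rw [exp_smul_eq_imag_mul_real _ T]
    have : ((0 : ℝ) + (1 : ℝ) * z : ℂ).re = 1 := by simp [hz]
    rw [this, one_smul, mul_assoc _ (exp T), ← mul_assoc (V₁ * W), mul_assoc, mul_assoc (exp T),
      ← mul_assoc, tr_mul_comm, ← mul_assoc]
    refine norm_tr_unitary_mul_exp_le (mul_mem (mul_mem h₂ ?_) (mul_mem (mul_mem h₁ hW) ?_)) hTs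
    · exact exp_imag_smul_mem_unitary hS (by simp [hz])
    · exact exp_imag_smul_mem_unitary hTs (by simp)

/-- Complex interpolation of Schatten norms along `z ↦ e^{(a + b z) H} e^{(c + d z) G}`. -/
lemma schatten_interpolation {H G : Obs K} (hH : IsSelfAdjoint H) (hG : IsSelfAdjoint G)
    (a b c d : ℝ) {s₀ s₁ θ C₀ C₁ : ℝ} (hθ₀ : 0 ≤ θ) (hθ₁ : θ ≤ 1) (hC₀ : 0 ≤ C₀) (hC₁ : 0 ≤ C₁)
    (hs : 0 < (1 - θ) * s₀ + θ * s₁)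
    (h₀ : HolderBound s₀ (exp (a • H) * exp (c • G)) C₀)
    (h₁ : HolderBound s₁ (exp ((a + b) • H) * exp ((c + d) • G)) C₁) :
    schatten ((1 - θ) * s₀ + θ * s₁) (exp ((a + b * θ) • H) * exp ((c + d * θ) • G)) ^
      ((1 - θ) * s₀ + θ * s₁) ≤ C₀ ^ (1 - θ) * C₁ ^ θ := by
  set s := (1 - θ) * s₀ + θ * s₁ with hs_def
  set M := exp ((a + b * θ) • H) * exp ((c + d * θ) • G) with hM_def
  obtain ⟨V, hV, S, hS, hSn, htr⟩ :=
    exists_tr_eq_schatten hs ((isUnit_exp' ((a + b * θ) • H)).mul (isUnit_exp' ((c + d * θ) • G)))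
  rw [← hM_def] at hSn htr
  set n := schatten s M with hn_def
  have hn : 0 < n := schatten_pos s M
  -- S is the optimizer at θ and stays fixed. Its coefficient 1 - s₀ + (s₀ - s₁)z has on each edge
  -- the real part occurring in the hypothesis there, and equals 1 - s at θ.
  have hF := norm_le_of_norm_le_strip
    (differentiable_tr_affine V 1 H G S a b c d (1 - s₀) (s₀ - s₁))
    (a := C₀ * n ^ (1 - s₀)) (b := C₁ * n ^ (1 - s₁))
    (exists_norm_tr_affine_le V 1 hH hG hS a b c d (1 - s₀) (s₀ - s₁)).choose_spec
    ?_ ?_ hθ₀ hθ₁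
  · have e1 : (a + b * (θ : ℂ)) • H = (a + b * θ) • H := by
      rw [← Complex.coe_smul]; push_cast; rfl
    have e2 : (c + d * (θ : ℂ)) • G = (c + d * θ) • G := by
      rw [← Complex.coe_smul]; push_cast; rfl
    have e3 : (((1 - s₀ : ℝ) : ℂ) + ((s₀ - s₁ : ℝ) : ℂ) * θ) • S = (1 - s) • S := by
      rw [← Complex.coe_smul, hs_def]; congr 1; push_cast; ring
    rw [e1, e2, e3, mul_one, ← hM_def, htr, Complex.norm_real, Real.norm_of_nonneg hn.le,
      Real.mul_rpow hC₀ (by positivity), Real.mul_rpow hC₁ (by positivity),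
      ← Real.rpow_mul hn.le, ← Real.rpow_mul hn.le, mul_mul_mul_comm, ← Real.rpow_add hn] at hF
    have e4 : (1 - s₀) * (1 - θ) + (1 - s₁) * θ = 1 - s := by rw [hs_def]; ring
    -- The three lines bound reads n ≤ C₀^{1-θ} C₁^θ n / n^s; cancelling n leaves the claim.
    rw [e4, Real.rpow_sub hn, Real.rpow_one, mul_div_assoc', le_div_iff₀ (by positivity),
      mul_comm] at hF
    exact le_of_mul_le_mul_right hF hn
  · intro z hz
    rw [exp_smul_eq_imag_mul_real _ H, exp_smul_eq_real_mul_imag _ G,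
      exp_smul_eq_imag_mul_real _ S]
    have e1 : (a + b * z : ℂ).re = a := by simp [hz]
    have e2 : (c + d * z : ℂ).re = c := by simp [hz]
    have e3 : (((1 - s₀ : ℝ) : ℂ) + ((s₀ - s₁ : ℝ) : ℂ) * z).re = 1 - s₀ := by simp [hz]
    rw [e1, e2, e3, ← hSn]
    convert h₀ (V * exp ((Complex.I * ((a + b * z : ℂ).im : ℂ)) • H)) ?_
      (exp ((Complex.I * ((c + d * z : ℂ).im : ℂ)) • G) *
      exp ((Complex.I * ((((1 - s₀ : ℝ) : ℂ) + ((s₀ - s₁ : ℝ) : ℂ) * z).im : ℂ)) • S)) ?_ S hS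
      using 3
    · simp only [mul_assoc, mul_one]
    · exact mul_mem hV (exp_imag_smul_mem_unitary hH (by simp))
    · exact mul_mem (exp_imag_smul_mem_unitary hG (by simp))
        (exp_imag_smul_mem_unitary hS (by simp))
  · intro z hz
    rw [exp_smul_eq_imag_mul_real _ H, exp_smul_eq_real_mul_imag _ G,
      exp_smul_eq_imag_mul_real _ S]
    have e1 : (a + b * z : ℂ).re = a + b := by simp [hz]
    have e2 : (c + d * z : ℂ).re = c + d := by simp [hz]
    have e3 : (((1 - s₀ : ℝ) : ℂ) + ((s₀ - s₁ : ℝ) : ℂ) * z).re = 1 - s₁ := by simp [hz]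
    rw [e1, e2, e3, ← hSn]
    convert h₁ (V * exp ((Complex.I * ((a + b * z : ℂ).im : ℂ)) • H)) ?_
      (exp ((Complex.I * ((c + d * z : ℂ).im : ℂ)) • G) *
      exp ((Complex.I * ((((1 - s₀ : ℝ) : ℂ) + ((s₀ - s₁ : ℝ) : ℂ) * z).im : ℂ)) • S)) ?_ S hS
      using 3
    · simp only [mul_assoc, mul_one]
    · exact mul_mem hV (exp_imag_smul_mem_unitary hH (by simp))
    · exact mul_mem (exp_imag_smul_mem_unitary hG (by simp))
        (exp_imag_smul_mem_unitary hS (by simp))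

/-- The Araki-Lieb-Thirring inequality. -/
lemma schatten_exp_smul_mul_exp_smul_le {H G : Obs K} (hH : IsSelfAdjoint H)
    (hG : IsSelfAdjoint G) {r s : ℝ} (hr : 0 < r) (hrs : r ≤ s) (hs : s ≤ 1) :
    schatten r (exp (r • H) * exp (r • G)) ≤ schatten s (exp (s • H) * exp (s • G)) := by
  have hs0 : 0 < s := hr.trans_le hrs
  have hu : IsUnit (exp (s • H) * exp (s • G)) := (isUnit_exp' _).mul (isUnit_exp' _)
  -- The left edge is the identity in operator norm (s₀ = 0), the right edge is the operator for s.
  -- At θ = r/s both the operator and the exponent are those for r.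
  have h := schatten_interpolation hH hG 0 s 0 s (s₀ := 0) (s₁ := s) (θ := r / s)
    (by positivity) ((div_le_one hs0).mpr hrs) zero_le_one
    (Real.rpow_nonneg (schatten_pos s _).le s) (by rw [mul_zero, zero_add]; positivity)
    (by simpa using holderBound_one_of_unitary (K := K) (one_mem _))
    (by simpa using holderBound_schatten hs0 hs hu)
  have e1 : (1 - r / s) * 0 + r / s * s = r := by field_simp; simp
  have e2 : 0 + s * (r / s) = r := by field_simp; simp
  rw [e1, e2, Real.one_rpow, one_mul, ← Real.rpow_mul (schatten_pos s _).le,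
    mul_div_cancel₀ _ hs0.ne'] at h
  exact (Real.rpow_le_rpow_iff (schatten_pos r _).le (schatten_pos s _).le hr).mp h

/-- Logarithmic convexity of Schatten norms along `x ↦ e^{s (1 - x) H} e^{s x G}`. -/
lemma convexOn_log_schatten {H G : Obs K} (hH : IsSelfAdjoint H) (hG : IsSelfAdjoint G) {s : ℝ}
    (hs : 0 < s) (hs' : s ≤ 1) : ConvexOn ℝ Set.univ fun x : ℝ =>
      Real.log (schatten s (exp ((s * (1 - x)) • H) * exp ((s * x) • G))) := by
  refine ⟨convex_univ, fun x _ y _ u v hu hv huv => ?_⟩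
  set N : ℝ → ℝ := fun x => schatten s (exp ((s * (1 - x)) • H) * exp ((s * x) • G))
  have hN : ∀ x, 0 < N x := fun x => schatten_pos s _
  have hB : ∀ x, HolderBound s (exp ((s * (1 - x)) • H) * exp ((s * x) • G)) (N x ^ s) :=
    fun x => holderBound_schatten hs hs' ((isUnit_exp' _).mul (isUnit_exp' _))
  have e0 : (1 - v) * s + v * s = s := by ring
  have h := schatten_interpolation hH hG (s * (1 - x)) (s * (x - y)) (s * x) (s * (y - x))
    (s₀ := s) (s₁ := s) (θ := v) hv (by linarith) (Real.rpow_nonneg (hN x).le s)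
    (Real.rpow_nonneg (hN y).le s) (by rwa [e0]) (hB x)
    (by convert hB y using 4 <;> ring_nf)
  have hu' : u = 1 - v := by linarith
  have e1 : s * (1 - x) + s * (x - y) * v = s * (1 - (u * x + v * y)) := by rw [hu']; ring
  have e2 : s * x + s * (y - x) * v = s * (u * x + v * y) := by rw [hu']; ring
  rw [e0, e1, e2, ← hu'] at h
  have h' := Real.log_le_log (Real.rpow_pos_of_pos (schatten_pos s _) _) h
  rw [Real.log_mul (by have := hN x; positivity) (by have := hN y; positivity),
    Real.log_rpow (Real.rpow_pos_of_pos (hN x) _), Real.log_rpow (Real.rpow_pos_of_pos (hN y) _),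
    Real.log_rpow (hN x), Real.log_rpow (hN y), Real.log_rpow (schatten_pos s _)] at h'
  refine le_of_mul_le_mul_left (h'.trans_eq ?_) hs
  simp only [smul_eq_mul, N]
  ring

end Interpolation

section

variable {K : Type*} [NormedAddCommGroup K] [InnerProductSpace ℂ K] [FiniteDimensional ℂ K]

lemma hasDerivAt_tr {F : ℝ → Obs K} {F' : Obs K} {a : ℝ} (hF : HasDerivAt F F' a) :
    HasDerivAt (fun x => tr (F x)) (tr F') a :=
  ((trCLM (K := K)).restrictScalars ℝ).hasFDerivAt.comp_hasDerivAt a hF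

end

/-! ### Real analyticity of the operator logarithm. -/

section LogAnalytic

variable {K : Type*} [NormedAddCommGroup K] [InnerProductSpace ℂ K] [CompleteSpace K]

/-- The Taylor series of `x ↦ log (1 - x)` at `0`, as a power series on the observables. -/
noncomputable def logSeries (K : Type*) [NormedAddCommGroup K] [InnerProductSpace ℂ K] :
    FormalMultilinearSeries ℝ (Obs K) (Obs K) :=
  FormalMultilinearSeries.ofScalars (Obs K) fun n : ℕ => -(n : ℝ)⁻¹

lemma one_le_radius_logSeries : 1 ≤ (logSeries K).radius := by
  have := FormalMultilinearSeries.inv_le_ofScalars_radius_of_tendsto (𝕜 := ℝ) (Obs K)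
    (fun n : ℕ => -(n : ℝ)⁻¹) (r := 1) one_ne_zero (by
      have h := tendsto_natCast_div_add_atTop (1 : ℝ)
      refine h.congr fun n => ?_
      simp [div_eq_mul_inv, mul_comm, abs_of_nonneg (by positivity : (0 : ℝ) ≤ n + 1)])
  simpa [logSeries] using this

lemma hasFPowerSeriesOnBall_logSeries :
    HasFPowerSeriesOnBall (logSeries K).sum (logSeries K) 0 1 :=
  ((logSeries K).hasFPowerSeriesOnBall (zero_lt_one.trans_le one_le_radius_logSeries)).mono
    zero_lt_one one_le_radius_logSeries

/-- The spectrum of Y lies in [-‖Y‖, ‖Y‖], where the scalar series converges uniformly by comparison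
with a geometric series. The functional calculus therefore carries its partial sums to the limit. -/
lemma logSeries_sum_eq {Y : Obs K} (hY : IsSelfAdjoint Y) (hY1 : ‖Y‖ < 1) :
    (logSeries K).sum Y = CFC.log (1 - Y) := by
  have h1 := (hasFPowerSeriesOnBall_logSeries (K := K)).hasSum (y := Y) (by
    simpa [Metric.mem_eball, edist_zero_right, ← ofReal_norm] using hY1)
  rw [zero_add] at h1
  have hspec : ∀ x ∈ spectrum ℝ Y, |x| ≤ ‖Y‖ := by
    intro x hx
    have : Nontrivial (Obs K) := by
      by_contra h
      rw [not_nontrivial_iff_subsingleton] at h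
      simp [spectrum.of_subsingleton] at hx
    exact spectrum.norm_le_norm_of_mem hx
  have hcfc : CFC.log (1 - Y) = cfc (fun x : ℝ => ∑' n : ℕ, -(n : ℝ)⁻¹ * x ^ n) Y := by
    have e : (1 : Obs K) - Y = cfc (fun x : ℝ => 1 - x) Y := by
      rw [cfc_sub .., cfc_const_one .., cfc_id' ..]
    have hne : ∀ x ∈ spectrum ℝ Y, 1 - x ≠ 0 := fun x hx => by
      have := (abs_lt.mp ((hspec x hx).trans_lt hY1)).2
      linarith
    rw [CFC.log, e, ← cfc_comp' Real.log (fun x : ℝ => 1 - x) Y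
      (Real.continuousOn_log.mono (by rintro _ ⟨x, hx, rfl⟩; exact hne x hx))]
    refine cfc_congr fun x hx => ?_
    have := Real.hasSum_pow_div_log_of_abs_lt_one ((hspec x hx).trans_lt hY1)
    -- The term n = 0 vanishes because 0⁻¹ = 0, so a series that starts at n = 1 may be indexed from
    -- 0.
    have h2 := (hasSum_nat_add_iff' (f := fun n : ℕ => -(n : ℝ)⁻¹ * x ^ n) 1
      (g := Real.log (1 - x))).mp (by
        have h3 := this.neg
        rw [neg_neg] at h3
        simpa [div_eq_inv_mul] using h3)
    exact h2.tsum_eq.symm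
  have h2 : Filter.Tendsto (fun N : ℕ => cfc (fun x : ℝ =>
      ∑ n ∈ Finset.range N, -(n : ℝ)⁻¹ * x ^ n) Y) Filter.atTop (𝓝 (CFC.log (1 - Y))) := by
    rw [hcfc]
    refine tendsto_cfc_fun (tendstoUniformlyOn_tsum_nat
      (summable_geometric_of_lt_one (norm_nonneg Y) hY1) fun n x hx => ?_)
      (Filter.Eventually.of_forall fun N => by fun_prop)
    rw [norm_mul, norm_pow, Real.norm_eq_abs, Real.norm_eq_abs]
    refine (mul_le_of_le_one_left (by positivity) ?_).trans
      (pow_le_pow_left₀ (abs_nonneg x) (hspec x hx) n)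
    rw [abs_neg, abs_of_nonneg (by positivity)]
    exact Nat.cast_inv_le_one n
  refine tendsto_nhds_unique h1.tendsto_sum_nat (h2.congr fun N => ?_)
  have e : (fun x : ℝ => ∑ n ∈ Finset.range N, -(n : ℝ)⁻¹ * x ^ n) =
      ∑ n ∈ Finset.range N, fun x : ℝ => -(n : ℝ)⁻¹ * x ^ n := by
    ext x; simp
  rw [e, cfc_sum _ _ _ fun n _ => by fun_prop]
  refine Finset.sum_congr rfl fun n _ => ?_
  rw [cfc_const_mul .., cfc_pow_id .., logSeries, FormalMultilinearSeries.ofScalars_apply_eq]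

/-- The logarithm is real analytic along analytic curves of positive invertible observables. -/
lemma analyticAt_log {M : ℝ → Obs K} {a : ℝ} (hM : AnalyticAt ℝ M a)
    (hsa : ∀ᶠ x in 𝓝 a, IsSelfAdjoint (M x)) (hpos : IsStrictlyPositive (M a)) :
    AnalyticAt ℝ (fun x => CFC.log (M x)) a := by
  -- Dividing by c puts the spectrum of M(a) inside (0, 1). Then Y = 1 - M/c has norm below 1 near
  -- a, and log M = log c + log(1 - Y).
  set c : ℝ := ‖M a‖ + 1 with hc_def
  have hc : 0 < c := by positivity
  set Y : ℝ → Obs K := fun x => 1 - c⁻¹ • M x with hY_def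
  have hYan : AnalyticAt ℝ Y a := analyticAt_const.fun_sub (hM.fun_const_smul (c := c⁻¹))
  have hYa : ‖Y a‖ < 1 := by
    have hsa' : IsSelfAdjoint (M a) := hpos.isSelfAdjoint
    have e : Y a = cfc (fun x : ℝ => 1 - c⁻¹ * x) (M a) := by
      rw [cfc_sub .., cfc_const_one .., cfc_const_mul .., cfc_id' ..]
    rw [e]
    refine norm_cfc_lt one_pos fun x hx => ?_
    have hx0 : 0 < x := hpos.spectrum_pos hx
    have : Nontrivial (Obs K) := by
      by_contra h
      rw [not_nontrivial_iff_subsingleton] at h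
      simp [spectrum.of_subsingleton] at hx
    have hx1 : x < c := by
      have := spectrum.norm_le_norm_of_mem hx
      rw [Real.norm_of_nonneg hx0.le] at this
      linarith
    have h1 : c⁻¹ * x < 1 := by rw [inv_mul_lt_iff₀ hc]; linarith
    have h2 : 0 < c⁻¹ * x := by positivity
    rw [Real.norm_eq_abs, abs_lt]
    constructor <;> linarith
  have hsum : AnalyticAt ℝ (logSeries K).sum (Y a) :=
    hasFPowerSeriesOnBall_logSeries.analyticAt_of_mem (by
      simpa [Metric.mem_eball, edist_zero_right, ← ofReal_norm] using hYa)
  have hcomp : AnalyticAt ℝ (fun x => algebraMap ℝ (Obs K) (Real.log c) + (logSeries K).sum (Y x)) a :=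
    analyticAt_const.fun_add (AnalyticAt.fun_comp hsum hYan)
  refine hcomp.congr ?_
  have hev : ∀ᶠ x in 𝓝 a, ‖Y x‖ < 1 := hYan.continuousAt.norm.eventually_lt_const hYa
  filter_upwards [hsa, hev] with x hx1 hx2
  have hYx : IsSelfAdjoint (Y x) := (IsSelfAdjoint.one _).sub (isSelfAdjoint_real_smul hx1 _)
  have hu : IsUnit (1 - Y x) := isUnit_one_sub_of_norm_lt_one hx2
  have e : M x = c • (1 - Y x) := by
    simp only [hY_def, sub_sub_cancel, smul_smul, mul_inv_cancel₀ hc.ne', one_smul]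
  rw [logSeries_sum_eq hYx hx2, e, CFC.log_smul _ _ hc.ne' ((IsSelfAdjoint.one _).sub hYx)]
  intro y hy h0
  rw [h0] at hy
  exact spectrum.zero_notMem ℝ hu hy

end LogAnalytic

/-! ### Duhamel's formula and derivatives of traces. -/

section Duhamel

variable {K : Type*} [NormedAddCommGroup K] [InnerProductSpace ℂ K] [CompleteSpace K]

lemma continuous_exp : Continuous (exp : Obs K → Obs K) :=
  continuous_iff_continuousAt.mpr fun X => (exp_analytic (𝕂 := ℂ) X).continuousAt

lemma analyticAt_exp (X : Obs K) : AnalyticAt ℝ (exp : Obs K → Obs K) X := exp_analytic X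

/-- Duhamel's integral `∫₀¹ e^{uY} Z e^{(1-u)X} du`. -/
noncomputable def duhamel (Y Z X : Obs K) : Obs K :=
  ∫ u in (0 : ℝ)..1, exp (u • Y) * Z * exp ((1 - u) • X)

lemma continuous_duhamel_integrand (Y Z X : Obs K) :
    Continuous fun u : ℝ => exp (u • Y) * Z * exp ((1 - u) • X) := by
  have := continuous_exp (K := K)
  fun_prop

/-- The fundamental theorem of calculus for u ↦ e^{uY} e^{(1-u)X}. -/
lemma exp_sub_exp (Y X : Obs K) : exp Y - exp X = duhamel Y (Y - X) X := by
  have hd : ∀ u : ℝ, HasDerivAt (fun u : ℝ => exp (u • Y) * exp ((1 - u) • X))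
      (exp (u • Y) * (Y - X) * exp ((1 - u) • X)) u := by
    intro u
    have h1 := hasDerivAt_exp_smul_const Y u
    have h2 : HasDerivAt (fun u : ℝ => exp ((1 - u) • X)) (-(X * exp ((1 - u) • X))) u :=
      ((hasDerivAt_exp_smul_const' X (1 - u)).scomp u
        ((hasDerivAt_id u).const_sub 1)).congr_deriv (by simp)
    refine (h1.mul h2).congr_deriv ?_
    rw [mul_neg, ← sub_eq_add_neg, mul_sub, sub_mul, mul_assoc (exp (u • Y)) X]
  rw [duhamel, intervalIntegral.integral_eq_sub_of_hasDerivAt (fun u _ => hd u)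
    ((continuous_duhamel_integrand _ _ _).intervalIntegrable _ _)]
  simp

lemma continuous_duhamel (X : Obs K) : Continuous fun p : Obs K × Obs K => duhamel p.1 p.2 X := by
  have h := continuous_exp (K := K)
  refine intervalIntegral.continuous_parametric_intervalIntegral_of_continuous' (f :=
    fun (p : Obs K × Obs K) (u : ℝ) => exp (u • p.1) * p.2 * exp ((1 - u) • X)) ?_ 0 1
  simp only [Function.uncurry_def]
  fun_prop

/-- Duhamel's formula for the derivative of the exponential. -/
lemma hasDerivAt_exp_comp {F : ℝ → Obs K} {F' : Obs K} {a : ℝ} (hF : HasDerivAt F F' a) :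
    HasDerivAt (fun x => exp (F x)) (duhamel (F a) F' (F a)) a := by
  rw [hasDerivAt_iff_tendsto_slope] at hF ⊢
  have h1 : Filter.Tendsto F (𝓝[≠] a) (𝓝 (F a)) := by
    have := (hasDerivAt_iff_tendsto_slope.mpr hF).continuousAt.tendsto
    exact this.mono_left nhdsWithin_le_nhds
  -- The slope of e^F is exactly a Duhamel integral with the slope of F in the middle, so joint
  -- continuity gives the limit.
  refine (((continuous_duhamel (F a)).tendsto (F a, F')).comp (h1.prodMk_nhds hF)).congr fun x => ?_
  simp only [Function.comp_apply, slope_def_module, exp_sub_exp, duhamel]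
  rw [← intervalIntegral.integral_smul]
  simp

variable [FiniteDimensional ℂ K]

/-- By cyclicity the two exponentials meet across C and merge into e^X, so the integrand is constant
in u. -/
lemma tr_mul_duhamel {C X : Obs K} (hC : Commute C X) (Z : Obs K) :
    tr (C * duhamel X Z X) = tr (C * exp X * Z) := by
  have hint := (continuous_duhamel_integrand X Z X).intervalIntegrable
    (μ := MeasureTheory.volume) 0 1
  have h1 : tr (C * duhamel X Z X) =
      ∫ u in (0 : ℝ)..1, tr (C * (exp (u • X) * Z * exp ((1 - u) • X))) := by
    have := ((trCLM (K := K)).comp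
      (ContinuousLinearMap.mul ℂ (Obs K) C)).intervalIntegral_comp_comm hint
    exact this.symm
  have h2 : ∀ u : ℝ, tr (C * (exp (u • X) * Z * exp ((1 - u) • X))) = tr (C * exp X * Z) := by
    intro u
    rw [← mul_assoc, tr_mul_comm, ← mul_assoc, ← mul_assoc,
      ← ((hC.smul_right (1 - u)).exp_right).eq, mul_assoc C, exp_real_smul_mul_exp_smul]
    simp
  simp only [h1, h2]
  simp

lemma tr_duhamel (X Z : Obs K) : tr (duhamel X Z X) = tr (exp X * Z) := by
  simpa using tr_mul_duhamel (Commute.one_left X) Z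

lemma hasDerivAt_tr_exp {F : ℝ → Obs K} {F' : Obs K} {a : ℝ} (hF : HasDerivAt F F' a) :
    HasDerivAt (fun x => tr (exp (F x))) (tr (exp (F a) * F')) a := by
  rw [← tr_duhamel]
  exact hasDerivAt_tr (hasDerivAt_exp_comp hF)

/-- The derivative of the trace of a real power of a curve of positive invertible observables. -/
lemma hasDerivAt_tr_exp_smul_log {M : ℝ → Obs K} {M' : Obs K} {a : ℝ} (hM : AnalyticAt ℝ M a)
    (hpos : ∀ x, IsStrictlyPositive (M x)) (hM' : HasDerivAt M M' a) (r : ℝ) :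
    HasDerivAt (fun x => tr (exp (r • CFC.log (M x))))
      (r * tr (exp ((r - 1) • CFC.log (M a)) * M')) a := by
  have hL := (analyticAt_log hM (Filter.Eventually.of_forall fun x => (hpos x).isSelfAdjoint)
    (hpos a)).differentiableAt.hasDerivAt
  -- The derivative of log M is never computed: M = e^{log M} expresses M' through it, and under the
  -- trace against a function of M(a) it is traded back for M'.
  have h1 : M' = duhamel (CFC.log (M a)) (deriv (fun x => CFC.log (M x)) a) (CFC.log (M a)) := by
    refine hM'.unique ((hasDerivAt_exp_comp hL).congr_of_eventuallyEq ?_)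
    exact Filter.Eventually.of_forall fun x => (CFC.exp_log _ (hpos x)).symm
  have h2 := hasDerivAt_tr_exp (hL.const_smul r)
  refine h2.congr_deriv ?_
  rw [h1, tr_mul_duhamel, mul_smul_comm, tr_real_smul]
  · congr 3
    nth_rewrite 2 [← one_smul ℝ (CFC.log (M a))]
    rw [exp_real_smul_mul_exp_smul]
    simp
  · exact (((Commute.refl _).smul_left _).exp_left)

end Duhamel

/-! ### Derivatives of the logarithm of a real function given by complex traces. -/

section RealDerivatives

lemma hasDerivAt_re {F : ℝ → ℂ} {D : ℂ} {a : ℝ} (h : HasDerivAt F D a) :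
    HasDerivAt (fun x => (F x).re) D.re a :=
  Complex.reCLM.hasFDerivAt.comp_hasDerivAt a h

lemma im_eq_zero_of_hasDerivAt {F : ℝ → ℂ} {D : ℂ} {a : ℝ} (h : HasDerivAt F D a)
    (hF : ∀ x, (F x).im = 0) : D.im = 0 := by
  have h1 : HasDerivAt (fun x => (F x).im) D.im a := Complex.imCLM.hasFDerivAt.comp_hasDerivAt a h
  simp only [hF] at h1
  exact h1.unique (hasDerivAt_const a 0)

lemma exists_hasDerivAt_log {F : ℝ → ℂ} {f : ℝ → ℝ} {D : ℂ} {a : ℝ} (hf : ∀ x, F x = f x)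
    (h : HasDerivAt F D a) (ha : f a = 1) :
    ∃ d : ℝ, HasDerivAt (fun x => Real.log (f x)) d a ∧ (d : ℂ) = D := by
  have h1 := hasDerivAt_re h
  simp only [hf, Complex.ofReal_re] at h1
  refine ⟨D.re, by simpa [ha] using h1.log (by simp [ha]), ?_⟩
  exact Complex.ext rfl (im_eq_zero_of_hasDerivAt h (by simp [hf])).symm

lemma exists_hasDerivAt_deriv_log {F F₁ : ℝ → ℂ} {f : ℝ → ℝ} {F₂ : ℂ} {a : ℝ}
    (hf : ∀ x, F x = f x) (hpos : ∀ x, 0 < f x) (h : ∀ x, HasDerivAt F (F₁ x) x)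
    (h₁ : HasDerivAt F₁ F₂ a) (ha : f a = 1) :
    ∃ d : ℝ, HasDerivAt (deriv fun x => Real.log (f x)) d a ∧ (d : ℂ) = F₂ - F₁ a ^ 2 := by
  have him : ∀ x, (F₁ x).im = 0 := fun x => im_eq_zero_of_hasDerivAt (h x) (by simp [hf])
  have h2 : ∀ x, HasDerivAt f (F₁ x).re x := fun x => by
    simpa only [hf, Complex.ofReal_re] using hasDerivAt_re (h x)
  have h3 : (deriv fun x => Real.log (f x)) = fun x => (F₁ x).re / f x :=
    funext fun x => ((h2 x).log (hpos x).ne').deriv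
  have h4 := (hasDerivAt_re h₁).fun_div (h2 a) (hpos a).ne'
  rw [h3]
  refine ⟨_, h4, ?_⟩
  have e1 : F₁ a = ((F₁ a).re : ℂ) := Complex.ext rfl (by simp [him])
  have e2 : F₂ = (F₂.re : ℂ) := Complex.ext rfl (by simp [im_eq_zero_of_hasDerivAt h₁ him])
  rw [ha, e1, e2]
  push_cast
  simp
  ring

end RealDerivatives

/-! ### The partition function: symmetry, analyticity, continuity, monotonicity, convexity. -/

section Pressure

variable {K : Type*} [NormedAddCommGroup K] [InnerProductSpace ℂ K] [CompleteSpace K]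

lemma star_exp_mul_exp_mul {H G : Obs K} (hH : IsSelfAdjoint H) (hG : IsSelfAdjoint G)
    (x y : ℝ) : star (exp (x • H) * exp (y • G)) * (exp (x • H) * exp (y • G)) =
      exp (y • G) * exp ((2 * x) • H) * exp (y • G) := by
  rw [star_mul, (isSelfAdjoint_exp (isSelfAdjoint_real_smul hH x)).star_eq,
    (isSelfAdjoint_exp (isSelfAdjoint_real_smul hG y)).star_eq, two_mul,
    ← exp_real_smul_mul_exp_smul]
  simp only [mul_assoc]

lemma exp_unitary_conj {U : Obs K} (hU : U ∈ unitary (Obs K)) (X : Obs K) :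
    exp (U * X * star U) = U * exp X * star U := by
  let _ : NormedAlgebra ℚ (Obs K) := NormedAlgebra.restrictScalars ℚ ℂ _
  exact exp_units_conj (Unitary.toUnits ⟨U, hU⟩) X

lemma isSelfAdjoint_interpolant {H G : Obs K} (hH : IsSelfAdjoint H) (hG : IsSelfAdjoint G)
    (x y : ℝ) : IsSelfAdjoint (x • H + y • G) :=
  (isSelfAdjoint_real_smul hH x).add (isSelfAdjoint_real_smul hG y)

lemma isStrictlyPositive_sandwich {H G : Obs K} (hH : IsSelfAdjoint H) (hG : IsSelfAdjoint G)
    (x y : ℝ) :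
    IsStrictlyPositive (exp (y • G) * exp ((2 * x) • H) * exp (y • G)) := by
  rw [← star_exp_mul_exp_mul hH hG]
  exact isStrictlyPositive_star_mul_self ((isUnit_exp' _).mul (isUnit_exp' _))

lemma analyticAt_exp_comp {E : Type*} [NormedAddCommGroup E] [NormedSpace ℝ E] {F : E → Obs K}
    {a : E} (hF : AnalyticAt ℝ F a) : AnalyticAt ℝ (fun x => exp (F x)) a :=
  (analyticAt_exp (F a)).fun_comp hF

lemma analyticAt_exp_smul {x : ℝ → ℝ} {a : ℝ} (hx : AnalyticAt ℝ x a) (H : Obs K) :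
    AnalyticAt ℝ (fun u => exp (x u • H)) a :=
  analyticAt_exp_comp (hx.fun_smul analyticAt_const)

lemma analyticAt_log_sandwich {H G : Obs K} (hH : IsSelfAdjoint H) (hG : IsSelfAdjoint G)
    {x y : ℝ → ℝ} {a : ℝ}   (hx : AnalyticAt ℝ x a) (hy : AnalyticAt ℝ y a) :
    AnalyticAt ℝ (fun u => CFC.log (exp (y u • G) * exp ((2 * x u) • H) * exp (y u • G))) a :=
  analyticAt_log (((analyticAt_exp_smul hy G).fun_mul
      (analyticAt_exp_smul (analyticAt_const.fun_mul hx) H)).fun_mul (analyticAt_exp_smul hy G))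
    (Filter.Eventually.of_forall fun _ => (isStrictlyPositive_sandwich hH hG _ _).isSelfAdjoint)
    (isStrictlyPositive_sandwich hH hG _ _)

lemma hasDerivAt_exp_mul_smul (c x : ℝ) (X : Obs K) :
    HasDerivAt (fun u : ℝ => exp ((c * u) • X)) (c • (exp ((c * x) • X) * X)) x :=
  (hasDerivAt_exp_smul_const X (c * x)).scomp x (by simpa using (hasDerivAt_id x).const_mul c)

lemma duhamel_zero (Z : Obs K) : duhamel 0 Z 0 = Z := by
  simp [duhamel]

/-- The Lie product formula, in differential form. -/
lemma hasDerivAt_log_sandwich {H G : Obs K} (hH : IsSelfAdjoint H) (hG : IsSelfAdjoint G) :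
    HasDerivAt (fun u : ℝ => CFC.log (exp (u • G) * exp ((2 * u) • H) * exp (u • G)))
      ((2 : ℝ) • (H + G)) 0 := by
  have hL := (analyticAt_log_sandwich hH hG (x := fun u => u) (y := fun u => u) (a := 0)
    analyticAt_id analyticAt_id).differentiableAt.hasDerivAt
  have h1 := hasDerivAt_exp_comp hL
  have h2 := ((hasDerivAt_exp_mul_smul 1 0 G).fun_mul (hasDerivAt_exp_mul_smul 2 0 H)).fun_mul
    (hasDerivAt_exp_mul_smul 1 0 G)
  simp only [one_mul] at h2
  -- At u = 0 the product is 1, its logarithm is 0, and exp has derivative the identity there. So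
  -- the logarithm has the same derivative as the product, G + 2H + G.
  have h3 := h1.unique (h2.congr_of_eventuallyEq (Filter.Eventually.of_forall fun u =>
    CFC.exp_log _ (isStrictlyPositive_sandwich hH hG _ _)))
  simp only [mul_zero, zero_smul, exp_zero, mul_one, one_mul, CFC.log_one, duhamel_zero,
    one_smul] at h3
  refine hL.congr_deriv (h3.trans ?_)
  rw [two_smul, two_smul]
  abel

/-- With the polar unitary W, M M* = W (M* M) W*, and the trace ignores the conjugation. -/
lemma schatten_star {M : Obs K} (hM : IsUnit M) (s : ℝ) : schatten s (star M) = schatten s M := by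
  obtain ⟨W, hW, hMW⟩ := exists_polar hM
  set T := CFC.log (star M * M) with hT
  have hTs : IsSelfAdjoint T := IsSelfAdjoint.log
  have h1 : star (star M) * star M = exp (W * T * star W) := by
    rw [star_star, hMW, star_mul, exp_unitary_conj hW,
      (isSelfAdjoint_exp (isSelfAdjoint_real_smul hTs _)).star_eq, ← mul_assoc, mul_assoc W,
      exp_real_smul_mul_exp_smul]
    norm_num
  have h2 : IsSelfAdjoint (W * T * star W) := by
    rw [isSelfAdjoint_iff, star_mul, star_mul, star_star, hTs.star_eq, mul_assoc]
  have h3 : (1 / (2 * s)) • (W * T * star W) = W * ((1 / (2 * s)) • T) * star W := by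
    rw [mul_smul_comm, smul_mul_assoc]
  rw [schatten, schatten, h1, CFC.log_exp _ h2, h3, trExp, trExp, exp_unitary_conj hW,
    tr_mul_comm, ← mul_assoc, (Unitary.mem_iff.mp hW).1, one_mul]

lemma schatten_exp {H : Obs K} (hH : IsSelfAdjoint H) {s : ℝ} (hs : s ≠ 0) :
    schatten s (exp (s • H)) = trExp H := by
  have h := isSelfAdjoint_real_smul hH s
  rw [schatten, (isSelfAdjoint_exp h).star_eq, exp_real_smul_mul_exp_smul,
    CFC.log_exp _ (isSelfAdjoint_real_smul hH _), smul_smul]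
  congr 1
  convert one_smul ℝ H using 2
  field_simp
  ring

variable [FiniteDimensional ℂ K]

/-- The function whose logarithm is the entropic pressure functional of exponent `p = 1 / s`, for
the density matrices `e^H` and `e^G`. -/
noncomputable def partitionFn (H G : Obs K) (s α : ℝ) : ℝ :=
  if s = 0 then trExp ((1 - α) • H + α • G)
  else schatten s (exp ((s * (1 - α)) • H) * exp ((s * α) • G))

variable {H G : Obs K} (hH : IsSelfAdjoint H) (hG : IsSelfAdjoint G)

include hH hG in
lemma partitionFn_pos [Nontrivial K] (s α : ℝ) : 0 < partitionFn H G s α := by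
  rw [partitionFn]
  split_ifs
  · exact trExp_pos (isSelfAdjoint_interpolant hH hG _ _)
  · exact schatten_pos _ _

omit [FiniteDimensional ℂ K] in
include hH hG in
lemma partitionFn_symm (s α : ℝ) : partitionFn H G s α = partitionFn G H s (1 - α) := by
  rw [partitionFn, partitionFn]
  split_ifs with h
  · rw [add_comm, sub_sub_cancel]
  · rw [← schatten_star ((isUnit_exp' _).mul (isUnit_exp' _)), star_mul,
      (isSelfAdjoint_exp (isSelfAdjoint_real_smul hH _)).star_eq,
      (isSelfAdjoint_exp (isSelfAdjoint_real_smul hG _)).star_eq, sub_sub_cancel]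

omit [FiniteDimensional ℂ K] in
include hH in
lemma partitionFn_zero (s : ℝ) : partitionFn H G s 0 = trExp H := by
  rw [partitionFn]
  split_ifs with h
  · simp
  · simp [schatten_exp hH h]

omit [FiniteDimensional ℂ K] in
include hG in
lemma partitionFn_one (s : ℝ) : partitionFn H G s 1 = trExp G := by
  rw [partitionFn]
  split_ifs with h
  · simp
  · simp [schatten_exp hG h]

lemma analyticAt_trExp_comp {F : ℝ → Obs K} {a : ℝ} (hF : AnalyticAt ℝ F a) :
    AnalyticAt ℝ (fun x => trExp (F x)) a :=
  ((Complex.reCLM.comp ((trCLM (K := K)).restrictScalars ℝ)).analyticAt _).fun_comp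
    (analyticAt_exp_comp hF)

include hH hG in
lemma analyticAt_partitionFn (s α : ℝ) : AnalyticAt ℝ (partitionFn H G s) α := by
  have h1 : AnalyticAt ℝ (fun α : ℝ => 1 - α) α := analyticAt_const.fun_sub analyticAt_id
  unfold partitionFn
  split_ifs with h
  · exact analyticAt_trExp_comp ((h1.fun_smul analyticAt_const).fun_add
      (analyticAt_id.fun_smul analyticAt_const))
  · simp only [schatten, star_exp_mul_exp_mul hH hG]
    exact analyticAt_trExp_comp ((analyticAt_log_sandwich hH hG (analyticAt_const.fun_mul h1)
      (analyticAt_const.fun_mul analyticAt_id)).fun_const_smul)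

-- With h(u) the logarithm of the sandwich for (1-α)H and αG, the exponent at s ≠ 0 is h(s)/(2s),
-- half a difference quotient at 0 since h(0) = 0. By the Lie formula the exponent at s = 0 is
-- h'(0)/2, so one continuous `dslope` covers both cases.
include hH hG in
lemma continuous_partitionFn (α : ℝ) : Continuous fun s => partitionFn H G s α := by
  set h : ℝ → Obs K := fun u =>
    CFC.log (exp (u • α • G) * exp ((2 * u) • (1 - α) • H) * exp (u • α • G)) with h_def
  have hH' := isSelfAdjoint_real_smul hH (1 - α)
  have hG' := isSelfAdjoint_real_smul hG α
  have hd := hasDerivAt_log_sandwich hH' hG'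
  have hcont : Continuous (dslope h 0) := continuous_iff_continuousAt.mpr fun u => by
    rcases eq_or_ne u 0 with rfl | hu
    · exact continuousAt_dslope_same.mpr hd.differentiableAt
    · exact (continuousAt_dslope_of_ne hu).mpr (analyticAt_log_sandwich hH' hG'
        (x := fun u => u) (y := fun u => u) analyticAt_id analyticAt_id).continuousAt
  have e : (fun s => partitionFn H G s α) = fun s => trExp ((1 / 2 : ℝ) • dslope h 0 s) := by
    ext s
    rw [partitionFn]
    split_ifs with hs
    · rw [hs, dslope_same, hd.deriv, smul_smul]
      norm_num
    · rw [dslope_of_ne _ hs, slope_def_module, schatten, star_exp_mul_exp_mul hH hG]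
      have h0 : h 0 = 0 := by simp [h_def]
      rw [h0, sub_zero, sub_zero, smul_smul, h_def]
      simp only [smul_smul, ← mul_assoc]
      congr 2
      field_simp
  rw [e]
  exact Complex.continuous_re.comp (continuous_tr.comp (continuous_exp.comp
    (show Continuous fun s => (1 / 2 : ℝ) • dslope h 0 s from hcont.const_smul (1 / 2 : ℝ))))

variable [Nontrivial K]

include hH hG in
lemma monotoneOn_partitionFn (α : ℝ) :
    MonotoneOn (fun s => partitionFn H G s α) (Set.Icc 0 1) := by
  have h1 : MonotoneOn (fun s => partitionFn H G s α) (Set.Ioc 0 1) := by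
    intro r hr s hs hrs
    simp only [partitionFn, hr.1.ne', hs.1.ne', if_false, mul_smul]
    exact schatten_exp_smul_mul_exp_smul_le (isSelfAdjoint_real_smul hH _)
      (isSelfAdjoint_real_smul hG _) hr.1 hrs hs.2
  intro r hr s hs hrs
  rcases hr.1.eq_or_lt with rfl | hr0
  · rcases hs.1.eq_or_lt with rfl | hs0
    · exact le_rfl
    -- The interpolation needs a positive parameter, so the endpoint 0 is reached by a limit from
    -- the right.
    · refine le_of_tendsto (((continuous_partitionFn hH hG α).tendsto 0).mono_left
        (nhdsWithin_le_nhds (s := Set.Ioi 0))) ?_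
      filter_upwards [Ioc_mem_nhdsGT hs0] with u hu
      exact h1 ⟨hu.1, hu.2.trans hs.2⟩ ⟨hs0, hs.2⟩ hu.2
  · exact h1 ⟨hr0, hr.2⟩ ⟨hr0.trans_le hrs, hs.2⟩ hrs

include hH hG in
lemma convexOn_log_partitionFn {s : ℝ} (hs : s ∈ Set.Icc (0 : ℝ) 1) :
    ConvexOn ℝ Set.univ fun α => Real.log (partitionFn H G s α) := by
  have h1 : ∀ s ∈ Set.Ioc (0 : ℝ) 1, ConvexOn ℝ Set.univ
      fun α => Real.log (partitionFn H G s α) := by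
    intro s hs
    simp only [partitionFn, hs.1.ne', if_false]
    exact convexOn_log_schatten hH hG hs.1 hs.2
  rcases hs.1.eq_or_lt with rfl | hs0
  · have hlim : ∀ α, Filter.Tendsto (fun s => Real.log (partitionFn H G s α)) (𝓝[>] 0)
        (𝓝 (Real.log (partitionFn H G 0 α))) := fun α =>
      (((continuous_partitionFn hH hG α).tendsto 0).log
        (partitionFn_pos hH hG 0 α).ne').mono_left nhdsWithin_le_nhds
    refine ⟨convex_univ, fun x hx y hy u v hu hv huv => ?_⟩
    refine le_of_tendsto_of_tendsto (hlim _)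
      (((hlim x).const_smul u).add ((hlim y).const_smul v)) ?_
    filter_upwards [Ioc_mem_nhdsGT (zero_lt_one (α := ℝ))] with s hs
    exact (h1 s hs).2 hx hy hu hv huv
  · exact h1 s ⟨hs0, hs.2⟩

end Pressure

/-! ### First and second derivatives in α. -/

section Derivatives

variable {K : Type*} [NormedAddCommGroup K] [InnerProductSpace ℂ K]

lemma hasDerivAt_interpolant (H G : Obs K) (α : ℝ) :
    HasDerivAt (fun α : ℝ => (1 - α) • H + α • G) (G - H) α := by
  have h1 := ((hasDerivAt_id α).const_sub 1).smul_const H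
  have h2 := (hasDerivAt_id α).smul_const G
  refine (h1.add h2).congr_deriv ?_
  simp [sub_eq_add_neg, add_comm]

variable [CompleteSpace K] {H G : Obs K}

lemma hasDerivAt_exp_smul_comp {x : ℝ → ℝ} {x' a : ℝ} (hx : HasDerivAt x x' a) (X : Obs K) :
    HasDerivAt (fun u => exp (x u • X)) (x' • (exp (x a • X) * X)) a :=
  (hasDerivAt_exp_smul_const X (x a)).scomp a hx

/-- The derivative at `α = 0` of `e^{sαG} e^{2s(1-α)H} e^{sαG}`. -/
noncomputable def sandwichDeriv (H G : Obs K) (s : ℝ) : Obs K :=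
  (s • G) * exp ((2 * s) • H) + (-(2 * s)) • (exp ((2 * s) • H) * H) +
    exp ((2 * s) • H) * (s • G)

/-- After cyclicity every term carries the full e^H, with weights s, -2s and s; the prefactor
cancels s. This is why the first derivative does not depend on p. -/
lemma tr_mul_sandwichDeriv (H G : Obs K) {s : ℝ} (hs : s ≠ 0) :
    ((1 / (2 * s) : ℝ) : ℂ) * tr (exp ((1 / (2 * s) - 1) • (2 * s) • H) * sandwichDeriv H G s) =
      tr (exp H * (G - H)) := by
  have hC : (1 / (2 * s) - 1) * (2 * s) = 1 - 2 * s := by field_simp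
  have hE : exp ((2 * s) • H) * exp ((1 - 2 * s) • H) = exp H := by
    rw [exp_real_smul_mul_exp_smul]; simp
  have hE' : exp ((1 - 2 * s) • H) * exp ((2 * s) • H) = exp H := by
    rw [exp_real_smul_mul_exp_smul]; simp
  have t1 : tr (exp ((1 - 2 * s) • H) * (G * exp ((2 * s) • H))) = tr (exp H * G) := by
    rw [← mul_assoc, tr_mul_comm, ← mul_assoc, hE]
  have t2 : tr (exp ((1 - 2 * s) • H) * (exp ((2 * s) • H) * H)) = tr (exp H * H) := by
    rw [← mul_assoc, hE']
  have t3 : tr (exp ((1 - 2 * s) • H) * (exp ((2 * s) • H) * G)) = tr (exp H * G) := by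
    rw [← mul_assoc, hE']
  rw [smul_smul, hC, sandwichDeriv, mul_add, mul_add, tr_add, tr_add, smul_mul_assoc,
    mul_smul_comm, mul_smul_comm, mul_smul_comm, mul_smul_comm, tr_real_smul, tr_real_smul,
    tr_real_smul, t1, t2, t3, mul_sub, tr_sub]
  push_cast
  have : (s : ℂ) ≠ 0 := by exact_mod_cast hs
  field_simp
  ring

variable [FiniteDimensional ℂ K]

lemma schatten_half {M : Obs K} (hM : IsUnit M) : tr (star M * M) = (schatten (1 / 2) M : ℂ) := by
  have : (1 / (2 * (1 / 2)) : ℝ) = 1 := by norm_num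
  rw [schatten, this, one_smul, ← tr_exp_eq IsSelfAdjoint.log, exp_log_star_mul_self hM]

lemma exists_hasDerivAt_log_partitionFn_zero (hH : IsSelfAdjoint H) (hG : IsSelfAdjoint G)
    (h1 : trExp H = 1) (s : ℝ) : ∃ d : ℝ,
      HasDerivAt (fun α => Real.log (partitionFn H G s α)) d 0 ∧
      (d : ℂ) = tr (exp H * (G - H)) := by
  have h0 : partitionFn H G s 0 = 1 := by rw [partitionFn_zero hH, h1]
  rcases eq_or_ne s 0 with rfl | hs
  · refine exists_hasDerivAt_log (F := fun α : ℝ => tr (exp ((1 - α) • H + α • G)))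
      (fun α => ?_) ?_ h0
    · rw [partitionFn, if_pos rfl, tr_exp_eq (isSelfAdjoint_interpolant hH hG _ _)]
    · simpa using hasDerivAt_tr_exp (hasDerivAt_interpolant H G 0)
  · set M : ℝ → Obs K := fun α =>
      exp ((s * α) • G) * exp ((2 * (s * (1 - α))) • H) * exp ((s * α) • G) with hM
    have hA : AnalyticAt ℝ (fun α : ℝ => s * α) 0 := analyticAt_const.fun_mul analyticAt_id
    have hB : AnalyticAt ℝ (fun α : ℝ => 2 * (s * (1 - α))) 0 :=
      analyticAt_const.fun_mul (analyticAt_const.fun_mul (analyticAt_const.fun_sub analyticAt_id))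
    have hMan : AnalyticAt ℝ M 0 :=
      ((analyticAt_exp_smul hA G).fun_mul (analyticAt_exp_smul hB H)).fun_mul
        (analyticAt_exp_smul hA G)
    have hlin : HasDerivAt (fun α : ℝ => 2 * (s * (1 - α))) (-(2 * s)) 0 :=
      ((((hasDerivAt_id (0 : ℝ)).const_sub 1).const_mul s).const_mul 2).congr_deriv (by ring)
    have hM' : HasDerivAt M (sandwichDeriv H G s) 0 := by
      refine (((hasDerivAt_exp_mul_smul s 0 G).fun_mul
        (hasDerivAt_exp_smul_comp hlin H)).fun_mul (hasDerivAt_exp_mul_smul s 0 G)).congr_deriv ?_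
      simp only [mul_zero, zero_smul, exp_zero, one_mul, mul_one, sub_zero, sandwichDeriv]
    have hpos : ∀ α, IsStrictlyPositive (M α) := fun α =>
      isStrictlyPositive_sandwich hH hG (s * (1 - α)) (s * α)
    have hd := hasDerivAt_tr_exp_smul_log hMan hpos hM' (1 / (2 * s))
    have hlog : CFC.log (M 0) = (2 * s) • H := by
      rw [← CFC.log_exp _ (isSelfAdjoint_real_smul hH (2 * s))]
      simp [hM]
    rw [hlog, tr_mul_sandwichDeriv H G hs] at hd
    refine exists_hasDerivAt_log (fun α => ?_) hd h0
    rw [partitionFn, if_neg hs, schatten, star_exp_mul_exp_mul hH hG]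
    exact tr_exp_eq (isSelfAdjoint_real_smul IsSelfAdjoint.log _)

lemma exists_hasDerivAt_log_partitionFn_one (hH : IsSelfAdjoint H) (hG : IsSelfAdjoint G)
    (h1 : trExp G = 1) (s : ℝ) : ∃ d : ℝ,
      HasDerivAt (fun α => Real.log (partitionFn H G s α)) d 1 ∧
      (d : ℂ) = tr (exp G * (G - H)) := by
  obtain ⟨d, hd, hd'⟩ := exists_hasDerivAt_log_partitionFn_zero hG hH h1 s
  refine ⟨-d, ?_, by rw [Complex.ofReal_neg, hd', mul_sub, mul_sub, tr_sub, tr_sub, neg_sub]⟩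
  simp only [partitionFn_symm hH hG]
  have h2 : HasDerivAt (fun α => Real.log (partitionFn G H s α)) d (1 - 1) := by rwa [sub_self]
  exact (h2.comp (1 : ℝ) ((hasDerivAt_id (1 : ℝ)).const_sub 1)).congr_deriv (by simp)

/-- At time -iu the modular flow of e^H is conjugation by e^{uH}, and e^{-uH} e^H = e^{(1-u)H}
yields the Duhamel integrand. -/
lemma stdCorrelation_exp (hH : IsSelfAdjoint H) {Z : Obs K} (hZ : IsSelfAdjoint Z) :
    stdCorrelation (exp H) Z Z = tr (duhamel H Z H * Z) := by
  have hint := (continuous_duhamel_integrand H Z H).intervalIntegrable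
    (μ := MeasureTheory.volume) 0 1
  have h1 := ((trCLM (K := K)).comp
    ((ContinuousLinearMap.mul ℂ (Obs K)).flip Z)).intervalIntegral_comp_comm hint
  have h2 : tr (duhamel H Z H * Z) =
      ∫ u in (0 : ℝ)..1, tr (exp (u • H) * Z * exp ((1 - u) • H) * Z) := h1.symm
  rw [h2, stdCorrelation]
  refine intervalIntegral.integral_congr fun u _ => ?_
  have e1 : (Complex.I * -(Complex.I * (u : ℂ))) • H = u • H := by
    rw [← Complex.coe_smul]
    congr 1
    rw [mul_neg, ← mul_assoc, Complex.I_mul_I]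
    ring
  have e2 : exp (-(u • H)) * exp H = exp ((1 - u) • H) := by
    rw [← exp_add_of_commute' ((Commute.refl H).smul_left u).neg_left, sub_smul, one_smul,
      neg_add_eq_sub]
  simp only [expect, modularFlow, CFC.log_exp H hH, e1, hZ.star_eq]
  rw [tr_mul_comm, mul_assoc Z, mul_assoc, e2, tr_mul_comm]

variable [Nontrivial K]

lemma exists_hasDerivAt_deriv_log_partitionFn_zero (hH : IsSelfAdjoint H) (hG : IsSelfAdjoint G)
    (h1 : trExp H = 1) : ∃ d : ℝ,
      HasDerivAt (deriv fun α => Real.log (partitionFn H G 0 α)) d 0 ∧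
      (d : ℂ) = tr (duhamel H (G - H) H * (G - H)) - tr (exp H * (G - H)) ^ 2 := by
  have h0 : partitionFn H G 0 0 = 1 := by rw [partitionFn_zero hH, h1]
  have := exists_hasDerivAt_deriv_log (F := fun α : ℝ => tr (exp ((1 - α) • H + α • G)))
    (F₁ := fun α : ℝ => tr (exp ((1 - α) • H + α • G) * (G - H)))
    (F₂ := tr (duhamel H (G - H) H * (G - H)))
    (f := partitionFn H G 0) (a := 0)
    (fun α => by rw [partitionFn, if_pos rfl, tr_exp_eq (isSelfAdjoint_interpolant hH hG _ _)])
    (partitionFn_pos hH hG 0) (fun α => hasDerivAt_tr_exp (hasDerivAt_interpolant H G α))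
    (hasDerivAt_tr (by
      simpa using (hasDerivAt_exp_comp (hasDerivAt_interpolant H G 0)).mul_const (G - H))) h0
  simpa using this

/-- For s = 1/2 the outer power is 1 and the trace reduces to tr(e^{(1-α)H} e^{αG}), which the
product rule differentiates without Duhamel integrals. -/
lemma exists_hasDerivAt_deriv_log_partitionFn_half (hH : IsSelfAdjoint H) (hG : IsSelfAdjoint G)
    (h1 : trExp H = 1) : ∃ d : ℝ,
      HasDerivAt (deriv fun α => Real.log (partitionFn H G (1 / 2) α)) d 0 ∧
      (d : ℂ) = tr (exp H * (G - H) ^ 2) - tr (exp H * (G - H)) ^ 2 := by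
  have h0 : partitionFn H G (1 / 2) 0 = 1 := by rw [partitionFn_zero hH, h1]
  have hH' : ∀ α : ℝ, HasDerivAt (fun α : ℝ => exp ((1 - α) • H)) (-(exp ((1 - α) • H) * H)) α :=
    fun α => (hasDerivAt_exp_smul_comp ((hasDerivAt_id α).const_sub 1) H).congr_deriv (by simp)
  have hG' : ∀ α : ℝ, HasDerivAt (fun α : ℝ => exp (α • G)) (G * exp (α • G)) α :=
    fun α => hasDerivAt_exp_smul_const' G α
  have hF : ∀ α : ℝ, HasDerivAt (fun α : ℝ => exp ((1 - α) • H) * exp (α • G))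
      (exp ((1 - α) • H) * (G - H) * exp (α • G)) α := fun α =>
    ((hH' α).fun_mul (hG' α)).congr_deriv (by noncomm_ring)
  have hF₁ := ((hH' 0).mul_const (G - H)).fun_mul (hG' 0)
  have := exists_hasDerivAt_deriv_log (F := fun α : ℝ => tr (exp ((1 - α) • H) * exp (α • G)))
    (f := partitionFn H G (1 / 2)) (a := 0) (fun α => ?_)
    (partitionFn_pos hH hG _) (fun α => hasDerivAt_tr (hF α)) (hasDerivAt_tr hF₁) h0
  · convert this using 5
    · simp only [sub_zero, one_smul, zero_smul, exp_zero, mul_one]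
      -- The product rule produces -2HG where (G - H)² has -GH - HG; the two agree against e^H,
      -- which commutes with H.
      have t1 : tr (exp H * (H * G)) = tr (exp H * (G * H)) := by
        rw [← mul_assoc, ← ((Commute.refl H).exp_right).eq, mul_assoc, tr_mul_comm, mul_assoc]
      have e1 : exp H * (G - H) ^ 2 =
        exp H * (G * G) - exp H * (G * H) - exp H * (H * G) + exp H * (H * H) := by noncomm_ring
      have e2 : -(exp H * H) * (G - H) + exp H * (G - H) * G =
        exp H * (G * G) - exp H * (H * G) - exp H * (H * G) + exp H * (H * H) := by noncomm_ring
      rw [e1, e2, tr_add, tr_sub, tr_sub, tr_add, tr_sub, tr_sub, t1]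
    · simp
  · rw [partitionFn, if_neg (by norm_num), ← schatten_half ((isUnit_exp' _).mul (isUnit_exp' _)),
      star_exp_mul_exp_mul hH hG, tr_mul_comm (exp _ * exp _), ← mul_assoc,
      exp_real_smul_mul_exp_smul, tr_mul_comm]
    congr 4 <;> ring

end Derivatives

/-! ### Invariance under trace preserving real *-homomorphisms. -/

section Invariance

variable {K : Type*} [NormedAddCommGroup K] [InnerProductSpace ℂ K] [CompleteSpace K]
  [FiniteDimensional ℂ K]

/-- Real linearity suffices for exp and log with real coefficients, so the antilinear time reversal
is covered together with the dynamics. -/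
lemma map_exp_real (φ : Obs K →⋆ₐ[ℝ] Obs K) (X : Obs K) : φ (exp X) = exp (φ X) := by
  let _ : NormedAlgebra ℚ (Obs K) := NormedAlgebra.restrictScalars ℚ ℂ _
  have : FiniteDimensional ℝ (Obs K) := FiniteDimensional.complexToReal (Obs K)
  exact map_exp φ (LinearMap.continuous_of_finiteDimensional (φ : Obs K →ₗ[ℝ] Obs K)) X

variable {φ : Obs K →⋆ₐ[ℝ] Obs K} (hφ : ∀ A, (tr (φ A)).re = (tr A).re)

include hφ in
lemma trExp_map (X : Obs K) : trExp (φ X) = trExp X := by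
  rw [trExp, ← map_exp_real, hφ, trExp]

include hφ in
lemma schatten_map {M : Obs K} (hM : IsUnit M) (s : ℝ) : schatten s (φ M) = schatten s M := by
  have h : CFC.log (star (φ M) * φ M) = φ (CFC.log (star M * M)) := by
    rw [← map_star, ← map_mul, ← exp_log_star_mul_self hM, map_exp_real,
      CFC.log_exp _ (IsSelfAdjoint.log.map φ), CFC.log_exp _ IsSelfAdjoint.log]
  rw [schatten, h, ← map_smul, trExp_map hφ, schatten]

include hφ in
/-- Trace preserving real automorphisms preserve the partition function. -/
lemma partitionFn_map (H G : Obs K) (s α : ℝ) :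
    partitionFn (φ H) (φ G) s α = partitionFn H G s α := by
  rw [partitionFn, partitionFn]
  split_ifs
  · rw [← map_smul, ← map_smul, ← map_add, trExp_map hφ]
  · rw [← map_smul, ← map_smul, ← map_exp_real, ← map_exp_real, ← map_mul,
      schatten_map hφ ((isUnit_exp' _).mul (isUnit_exp' _))]

lemma tr_map (τ : Obs K ≃⋆ₐ[ℂ] Obs K) (A : Obs K) : tr (τ A) = tr A := by
  let e := Module.End.toContinuousLinearMap (𝕜 := ℂ) K
  exact LinearMap.trace_map ((e.trans (τ.toAlgEquiv)).trans e.symm) (e.symm A)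

lemma tr_eq_zero_of_forall {X : Obs K} (h : ∀ A, tr (X * A) = 0) : X = 0 := by
  have h1 := h (star X)
  rw [tr_mul_comm] at h1
  rw [tr_star_mul_self] at h1
  have h2 := (Finset.sum_eq_zero_iff_of_nonneg (fun i _ => by positivity)).mp
    (Complex.ofReal_eq_zero.mp h1)
  ext x
  have h3 : (X : K →ₗ[ℂ] K) = 0 := (stdOrthonormalBasis ℂ K).toBasis.ext fun i => by
    simpa using h2 i (Finset.mem_univ i)
  exact LinearMap.congr_fun h3 x

end Invariance

/-! ### Time reversal and the trace. -/

section TimeReversal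

variable {K : Type*} [NormedAddCommGroup K] [InnerProductSpace ℂ K] [CompleteSpace K]
  [FiniteDimensional ℂ K] {Q : QuantumDynamicalSystem K} {Θ : Obs K →ₗ⋆[ℂ] Obs K}

namespace QuantumDynamicalSystem.IsTimeReversal

omit [FiniteDimensional ℂ K] in
lemma map_one (h : Q.IsTimeReversal Θ) : Θ 1 = 1 := by
  have := h.map_mul (Θ 1) 1
  rwa [mul_one, h.involutive, one_mul, eq_comm] at this

/-- A time reversal as a homomorphism of real `*`-algebras. -/
def toStarAlgHom (h : Q.IsTimeReversal Θ) : Obs K →⋆ₐ[ℝ] Obs K where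
  toFun := Θ
  map_one' := h.map_one
  map_mul' := h.map_mul
  map_zero' := map_zero Θ
  map_add' := map_add Θ
  commutes' r := by
    rw [Algebra.algebraMap_eq_smul_one, ← Complex.coe_smul, map_smulₛₗ, h.map_one]
    simp
  map_star' := h.map_star

/-- In an orthonormal basis, Θ preceded by entrywise conjugation is a complex-linear algebra
endomorphism of a matrix algebra, and such maps preserve the trace. -/
lemma tr_map (h : Q.IsTimeReversal Θ) (A : Obs K) : tr (Θ A) = star (tr A) := by
  let b := (stdOrthonormalBasis ℂ K).toBasis
  let e := (Module.End.toContinuousLinearMap (𝕜 := ℂ) K).symm.trans (LinearMap.toMatrixAlgEquiv b)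
  have he : ∀ X, (e X).trace = tr X := fun X => (LinearMap.trace_eq_matrix_trace ℂ b _).symm
  let ψ : Matrix _ _ ℂ →ₐ[ℂ] Matrix _ _ ℂ :=
    { toFun := fun M => e (Θ (e.symm (M.map (starRingEnd ℂ))))
      map_one' := by simp [h.map_one]
      map_mul' := fun M N => by simp [Matrix.map_mul, h.map_mul]
      map_zero' := by simp
      map_add' := fun M N => by simp [Matrix.map_add]
      commutes' := fun r => by
        have : (algebraMap ℂ (Matrix (Fin (Module.finrank ℂ K)) (Fin (Module.finrank ℂ K)) ℂ)
            r).map (starRingEnd ℂ) = algebraMap ℂ _ (starRingEnd ℂ r) := by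
          ext i j
          rw [Matrix.map_apply, Matrix.algebraMap_matrix_apply, Matrix.algebraMap_matrix_apply]
          split_ifs <;> simp
        rw [this, AlgEquiv.commutes, Algebra.algebraMap_eq_smul_one, map_smulₛₗ, h.map_one,
          Complex.conj_conj, map_smul, _root_.map_one, Algebra.algebraMap_eq_smul_one] }
  have h1 := Matrix.trace_map' ψ ((e A).map (starRingEnd ℂ))
  have h2 : ((e A).map (starRingEnd ℂ)).map (starRingEnd ℂ) = e A := by ext; simp
  have h3 : ψ ((e A).map (starRingEnd ℂ)) = e (Θ A) := by
    change e (Θ (e.symm (((e A).map (starRingEnd ℂ)).map (starRingEnd ℂ)))) = _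
    rw [h2, e.symm_apply_apply]
  rw [h3, he] at h1
  rw [h1, ← he A, Matrix.trace, Matrix.trace, star_sum]
  rfl

end QuantumDynamicalSystem.IsTimeReversal

end TimeReversal

section

variable {K : Type*} [NormedAddCommGroup K] [InnerProductSpace ℂ K]

lemma IsFaithfulState.nontrivial {ρ : Obs K} (hρ : IsFaithfulState ρ) : Nontrivial K := by
  by_contra h
  rw [not_nontrivial_iff_subsingleton] at h
  have := hρ.tr_eq_one
  rw [Subsingleton.elim ρ 0, ← zero_smul ℂ (0 : Obs K), tr_smul, zero_mul] at this
  exact zero_ne_one this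

end

/-! ### From the dynamical system to the partition function. -/

section Assembly

variable {K : Type*} [NormedAddCommGroup K] [InnerProductSpace ℂ K] [CompleteSpace K]

lemma rpow_eq_exp_smul_log {A : Obs K} (hA : IsStrictlyPositive A) (x : ℝ) :
    A ^ x = exp (x • CFC.log A) := by
  have hne : ∀ y ∈ spectrum ℝ A, y ≠ 0 := fun y hy => (hA.spectrum_pos hy).ne'
  have hsa : IsSelfAdjoint A := hA.isSelfAdjoint
  have hlog : ContinuousOn Real.log (spectrum ℝ A) := Real.continuousOn_log.mono hne
  rw [CFC.rpow_eq_cfc_real hA.nonneg, CFC.log, ← cfc_const_mul x Real.log A hlog,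
    ← CFC.real_exp_eq_normedSpace_exp (cfc_predicate _ A),
    ← cfc_comp' Real.exp (fun y => x * Real.log y) A (by fun_prop)
      (continuousOn_const.mul hlog)]
  refine cfc_congr fun y hy => ?_
  simp only [Real.rpow_def_of_pos (hA.spectrum_pos hy), mul_comm]

variable [FiniteDimensional ℂ K]

lemma IsFaithfulState.isStrictlyPositive {ρ : Obs K} (hρ : IsFaithfulState ρ) :
    IsStrictlyPositive ρ := by
  have hinj : Function.Injective (ρ : K →ₗ[ℂ] K) := LinearMap.ker_eq_bot.mp hρ.ker_eq_bot
  have hu : IsUnit ρ := ContinuousLinearMap.isUnit_iff_bijective.mpr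
    ⟨hinj, LinearMap.injective_iff_surjective.mp hinj⟩
  exact hu.isStrictlyPositive ((ContinuousLinearMap.nonneg_iff_isPositive ρ).mpr hρ.isPositive)

omit [FiniteDimensional ℂ K] in
lemma relEntropy_exp {H G : Obs K} (hH : IsSelfAdjoint H) (hG : IsSelfAdjoint G) :
    relEntropy (exp H) (exp G) = (((tr (exp H * (G - H))).re : ℝ) : EReal) := by
  have hr : LinearMap.range ((exp G : Obs K) : K →ₗ[ℂ] K) = ⊤ :=
    LinearMap.range_eq_top.mpr
      (ContinuousLinearMap.isUnit_iff_bijective.mp (isUnit_exp' G)).surjective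
  rw [relEntropy, if_pos (hr ▸ le_top), CFC.log_exp H hH, CFC.log_exp G hG]

namespace QuantumDynamicalSystem

variable (Q : QuantumDynamicalSystem K)

/-- The logarithm of the reference state. -/
noncomputable def logRef : Obs K := CFC.log Q.ω

/-- The evolution of the logarithm of the reference state. -/
noncomputable def logState (t : ℝ) : Obs K := Q.τ (-t) Q.logRef

omit [FiniteDimensional ℂ K] in
lemma isSelfAdjoint_logRef : IsSelfAdjoint Q.logRef := IsSelfAdjoint.log

omit [FiniteDimensional ℂ K] in
lemma isSelfAdjoint_logState (t : ℝ) : IsSelfAdjoint (Q.logState t) :=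
  Q.isSelfAdjoint_logRef.map (Q.τ (-t))

/-- The dynamics as homomorphisms of real `*`-algebras. -/
noncomputable def dyn (t : ℝ) : Obs K →⋆ₐ[ℝ] Obs K :=
  StarAlgHom.restrictScalars ℝ (Q.τ t : Obs K →⋆ₐ[ℂ] Obs K)

omit [FiniteDimensional ℂ K] in
lemma dyn_apply (t : ℝ) (A : Obs K) : Q.dyn t A = Q.τ t A := rfl

lemma tr_dyn (t : ℝ) (A : Obs K) : tr (Q.dyn t A) = tr A := tr_map (Q.τ t) A

lemma exp_logRef : exp Q.logRef = Q.ω := CFC.exp_log _ Q.faithful.isStrictlyPositive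

lemma exp_logState (t : ℝ) : exp (Q.logState t) = Q.state t := by
  rw [state, ← exp_logRef, ← dyn_apply, map_exp_real, dyn_apply, logState]

lemma log_state (t : ℝ) : CFC.log (Q.state t) = Q.logState t := by
  rw [← exp_logState, CFC.log_exp _ (Q.isSelfAdjoint_logState t)]

lemma trExp_logRef : trExp Q.logRef = 1 := by
  rw [trExp, exp_logRef, Q.faithful.tr_eq_one, Complex.one_re]

lemma trExp_logState (t : ℝ) : trExp (Q.logState t) = 1 := by
  rw [← Q.trExp_logRef, logState, ← dyn_apply]
  exact trExp_map (fun A => by rw [tr_dyn]) _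

lemma ell_eq (t : ℝ) : Q.ell t = Q.logState t - Q.logRef := by
  rw [ell, relHamiltonian, log_state, logRef]

omit [FiniteDimensional ℂ K] in
lemma τ_zero (A : Obs K) : Q.τ 0 A = A := by
  have h : Q.τ 0 (Q.τ 0 A) = Q.τ 0 A := by rw [Q.group_law, add_zero]
  exact EquivLike.injective (Q.τ 0) h

lemma pressure_eq (p : ℝ≥0∞) (hp : 1 ≤ p) (t α : ℝ) : Q.pressure p t α =
    Real.log (partitionFn Q.logRef (Q.logState t) p⁻¹.toReal α) := by
  rcases eq_or_ne p ∞ with rfl | hp'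
  · rw [pressure, if_pos rfl, partitionFn, if_pos (by simp), log_state, trExp, logRef]
  · have hp0 : p.toReal ≠ 0 := (ENNReal.toReal_pos (by positivity) hp').ne'
    have hH := Q.isSelfAdjoint_logRef
    have hG := Q.isSelfAdjoint_logState t
    have hstate : IsStrictlyPositive (Q.state t) := by
      rw [← exp_logState]; exact isStrictlyPositive_exp hG
    -- The pressure has ω on the outside, while M* M for `partitionFn` has the evolved state there;
    -- the swap symmetry reconciles them.
    rw [pressure, if_neg hp', partitionFn_symm hH hG, partitionFn,
      if_neg (by rw [ENNReal.toReal_inv]; exact inv_ne_zero hp0), schatten,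
      star_exp_mul_exp_mul hG hH, rpow_eq_exp_smul_log Q.faithful.isStrictlyPositive,
      rpow_eq_exp_smul_log hstate, log_state, ENNReal.toReal_inv, sub_sub_cancel, ← logRef]
    have e1 : (1 - α) / p.toReal = p.toReal⁻¹ * (1 - α) := by ring
    have e2 : 2 * α / p.toReal = 2 * (p.toReal⁻¹ * α) := by ring
    have e3 : p.toReal / 2 = 1 / (2 * p.toReal⁻¹) := by field_simp
    rw [e1, e2, e3, rpow_eq_exp_smul_log (isStrictlyPositive_sandwich hG hH _ _), trExp]

lemma toReal_inv_mem_Icc {p : ℝ≥0∞} (hp : 1 ≤ p) : p⁻¹.toReal ∈ Set.Icc (0 : ℝ) 1 := by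
  refine ⟨ENNReal.toReal_nonneg, ?_⟩
  simpa using ENNReal.toReal_mono ENNReal.one_ne_top (ENNReal.inv_le_one.mpr hp)

lemma continuousOn_pressure (t α : ℝ) :
    ContinuousOn (fun p : ℝ≥0∞ => Q.pressure p t α) (Set.Icc 1 ∞) := by
  have := Q.faithful.nontrivial
  have h1 : ContinuousOn (fun p : ℝ≥0∞ => p⁻¹.toReal) (Set.Icc 1 ∞) :=
    ENNReal.continuousOn_toReal.comp continuous_inv.continuousOn fun p hp =>
      ENNReal.inv_ne_top.mpr (zero_lt_one.trans_le hp.1).ne'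
  refine ContinuousOn.congr (f := fun p : ℝ≥0∞ =>
    Real.log (partitionFn Q.logRef (Q.logState t) p⁻¹.toReal α)) ?_
    fun p hp => Q.pressure_eq p hp.1 t α
  exact ((continuous_partitionFn Q.isSelfAdjoint_logRef (Q.isSelfAdjoint_logState t)
    α).comp_continuousOn h1).log fun p _ =>
      (partitionFn_pos Q.isSelfAdjoint_logRef (Q.isSelfAdjoint_logState t) _ _).ne'

lemma antitoneOn_pressure (t α : ℝ) :
    AntitoneOn (fun p : ℝ≥0∞ => Q.pressure p t α) (Set.Icc 1 ∞) := by
  have := Q.faithful.nontrivial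
  intro p hp q hq hpq
  simp only [Q.pressure_eq _ hp.1, Q.pressure_eq _ hq.1]
  refine Real.log_le_log (partitionFn_pos Q.isSelfAdjoint_logRef (Q.isSelfAdjoint_logState t) _ _)
    (monotoneOn_partitionFn Q.isSelfAdjoint_logRef (Q.isSelfAdjoint_logState t) α
      (toReal_inv_mem_Icc hq.1) (toReal_inv_mem_Icc hp.1) ?_)
  exact ENNReal.toReal_mono (ENNReal.inv_ne_top.mpr (zero_lt_one.trans_le hp.1).ne')
    (ENNReal.inv_le_inv.mpr hpq)

/-- Applying τ^t to the pair (log ω, log ω_t) gives (log ω_{-t}, log ω); swapping the entries turns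
α into 1 - α. -/
lemma pressure_symm (p : ℝ≥0∞) (hp : 1 ≤ p) (t α : ℝ) :
    Q.pressure p t α = Q.pressure p (-t) (1 - α) := by
  rw [Q.pressure_eq p hp, Q.pressure_eq p hp,
    ← partitionFn_map (φ := Q.dyn t) (fun A => by rw [tr_dyn]) Q.logRef (Q.logState t),
    partitionFn_symm (Q.isSelfAdjoint_logRef.map _) ((Q.isSelfAdjoint_logState t).map _)]
  congr 2
  · rw [dyn_apply, logState, Q.group_law, add_neg_cancel, τ_zero]
  · rw [dyn_apply, logState, neg_neg]

lemma pressure_neg_of_isTRI (h : Q.IsTRI) (p : ℝ≥0∞) (hp : 1 ≤ p) (t α : ℝ) :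
    Q.pressure p (-t) α = Q.pressure p t α := by
  obtain ⟨Θ, hΘ, hω⟩ := h
  -- Since Θ conjugates traces, tr(Θ(ω) A) is the conjugate of tr(ω Θ(A)) = tr(ω A*), hence equals
  -- tr(ω A) for every A.
  have hΘω : Θ Q.ω = Q.ω := by
    refine sub_eq_zero.mp (tr_eq_zero_of_forall fun A => ?_)
    have h1 : tr (Θ (Θ Q.ω * A)) = tr (Q.ω * star A) := by
      rw [hΘ.map_mul, hΘ.involutive]
      exact hω A
    have h2 : tr (Q.ω * A) = star (tr (Q.ω * star A)) := by
      rw [← tr_star, star_mul, star_star, Q.faithful.isPositive.isSelfAdjoint.star_eq, tr_mul_comm]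
    rw [sub_mul, tr_sub, h2, ← h1, hΘ.tr_map, star_star, sub_self]
  have hlog : hΘ.toStarAlgHom Q.logRef = Q.logRef := by
    have h1 : exp (hΘ.toStarAlgHom Q.logRef) = Q.ω := by
      rw [← map_exp_real, exp_logRef]
      exact hΘω
    rw [← CFC.log_exp _ (Q.isSelfAdjoint_logRef.map hΘ.toStarAlgHom), h1, logRef]
  have hstate : hΘ.toStarAlgHom (Q.logState t) = Q.logState (-t) := by
    rw [logState, logState, neg_neg]
    exact (hΘ.reverses t Q.logRef).symm.trans (congrArg (Q.τ t) hlog)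
  rw [Q.pressure_eq p hp, Q.pressure_eq p hp, ← hstate]
  nth_rewrite 1 [← hlog]
  rw [partitionFn_map]
  intro A
  change (tr (Θ A)).re = _
  rw [hΘ.tr_map]
  exact Complex.conj_re _

end QuantumDynamicalSystem

lemma nonpos_of_convexOn {f : ℝ → ℝ} (hf : ConvexOn ℝ Set.univ f) (h0 : f 0 = 0) (h1 : f 1 = 0)
    {x : ℝ} (hx : x ∈ Set.Icc (0 : ℝ) 1) : f x ≤ 0 := by
  have := hf.2 (Set.mem_univ 0) (Set.mem_univ 1) (sub_nonneg.mpr hx.2) hx.1 (by ring)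
  simpa [h0, h1] using this

/-- The endpoint of [0,1] nearer to x is a convex combination of x and the other endpoint, with
positive weight on x. -/
lemma nonneg_of_convexOn {f : ℝ → ℝ} (hf : ConvexOn ℝ Set.univ f) (h0 : f 0 = 0) (h1 : f 1 = 0)
    {x : ℝ} (hx : x ∉ Set.Icc (0 : ℝ) 1) : 0 ≤ f x := by
  rw [Set.mem_Icc, not_and_or, not_le, not_le] at hx
  rcases hx with hx | hx
  · have := hf.2 (Set.mem_univ x) (Set.mem_univ 1) (show 0 ≤ 1 / (1 - x) from by
        have : 0 < 1 - x := by linarith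
        positivity) (show 0 ≤ -x / (1 - x) from div_nonneg (by linarith) (by linarith))
      (by have : 1 - x ≠ 0 := by linarith
          field_simp; ring)
    have e : (1 / (1 - x)) • x + (-x / (1 - x)) • (1 : ℝ) = 0 := by
      simp only [smul_eq_mul]; ring
    rw [e, h0, h1, smul_zero, add_zero, smul_eq_mul] at this
    exact nonneg_of_mul_nonneg_right this (one_div_pos.mpr (by linarith))
  · have hx0 : 0 < x := zero_lt_one.trans hx
    have := hf.2 (Set.mem_univ 0) (Set.mem_univ x)
      (show 0 ≤ (x - 1) / x from div_nonneg (by linarith) hx0.le)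
      (show 0 ≤ 1 / x by positivity) (by field_simp; ring)
    have e : ((x - 1) / x) • (0 : ℝ) + (1 / x) • x = 1 := by
      simp only [smul_eq_mul]; field_simp; ring
    rw [e, h0, h1, smul_zero, zero_add, smul_eq_mul] at this
    exact nonneg_of_mul_nonneg_right this (by positivity)

end Assembly

end FiniteQuantum

open FiniteQuantum

theorem proposition3p1 {K : Type*} [NormedAddCommGroup K] [InnerProductSpace ℂ K]
    [CompleteSpace K] [FiniteDimensional ℂ K]
    (Q : FiniteQuantum.QuantumDynamicalSystem K) (t : ℝ) :
    -- (1) continuity and monotonicity in `p ∈ [1,∞]`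
    (∀ α : ℝ, ContinuousOn (fun p : ℝ≥0∞ => Q.pressure p t α) (Set.Icc 1 ∞) ∧
      AntitoneOn (fun p : ℝ≥0∞ => Q.pressure p t α) (Set.Icc 1 ∞)) ∧
    -- (2) analyticity, convexity, normalization and sign in `α`
    (∀ p : ℝ≥0∞, 1 ≤ p →
      AnalyticOnNhd ℝ (fun α : ℝ => Q.pressure p t α) Set.univ ∧
      ConvexOn ℝ Set.univ (fun α : ℝ => Q.pressure p t α) ∧
      Q.pressure p t 0 = 0 ∧ Q.pressure p t 1 = 0 ∧
      (∀ α ∈ Set.Icc (0 : ℝ) 1, Q.pressure p t α ≤ 0) ∧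
      (∀ α ∉ Set.Icc (0 : ℝ) 1, 0 ≤ Q.pressure p t α)) ∧
    -- (3) the general symmetry
    (∀ p : ℝ≥0∞, 1 ≤ p → ∀ α : ℝ, Q.pressure p t α = Q.pressure p (-t) (1 - α)) ∧
    -- (4) first derivatives at `α = 0` and `α = 1`
    (∀ p : ℝ≥0∞, 1 ≤ p →
      (∃ d : ℝ, HasDerivAt (fun α : ℝ => Q.pressure p t α) d 0 ∧
        (d : ℂ) = FiniteQuantum.expect Q.ω (Q.ell t) ∧
        (d : EReal) = FiniteQuantum.relEntropy Q.ω (Q.state t)) ∧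
      (∃ d : ℝ, HasDerivAt (fun α : ℝ => Q.pressure p t α) d 1 ∧
        (d : ℂ) = FiniteQuantum.expect (Q.state t) (Q.ell t) ∧
        (d : EReal) = -FiniteQuantum.relEntropy (Q.state t) Q.ω)) ∧
    -- (5) second derivative at `α = 0` for `p = ∞`
    (∃ d : ℝ, HasDerivAt (deriv fun α : ℝ => Q.pressure ∞ t α) d 0 ∧
      (d : ℂ) = FiniteQuantum.stdCorrelation Q.ω (Q.ell t) (Q.ell t)
        - FiniteQuantum.expect Q.ω (Q.ell t) ^ 2) ∧
    -- (6) second derivative at `α = 0` for `p = 2`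
    (∃ d : ℝ, HasDerivAt (deriv fun α : ℝ => Q.pressure 2 t α) d 0 ∧
      (d : ℂ) = FiniteQuantum.expect Q.ω (Q.ell t ^ 2)
        - FiniteQuantum.expect Q.ω (Q.ell t) ^ 2) ∧
    -- (7) the finite time quantum Evans-Searles symmetry
    (Q.IsTRI → ∀ p : ℝ≥0∞, 1 ≤ p → ∀ α : ℝ, Q.pressure p t α = Q.pressure p t (1 - α)) := by
  have := Q.faithful.nontrivial
  have hH := Q.isSelfAdjoint_logRef
  have hG := Q.isSelfAdjoint_logState t
  have hfun : ∀ p : ℝ≥0∞, 1 ≤ p → (fun α => Q.pressure p t α) =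
      fun α => Real.log (partitionFn Q.logRef (Q.logState t) p⁻¹.toReal α) :=
    fun p hp => funext fun α => Q.pressure_eq p hp t α
  have h0 : ∀ p : ℝ≥0∞, 1 ≤ p → Q.pressure p t 0 = 0 := fun p hp => by
    rw [Q.pressure_eq p hp, partitionFn_zero hH, Q.trExp_logRef, Real.log_one]
  have h1 : ∀ p : ℝ≥0∞, 1 ≤ p → Q.pressure p t 1 = 0 := fun p hp => by
    rw [Q.pressure_eq p hp, partitionFn_one hG, Q.trExp_logState, Real.log_one]
  have hconv : ∀ p : ℝ≥0∞, 1 ≤ p → ConvexOn ℝ Set.univ fun α => Q.pressure p t α := fun p hp => by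
    rw [hfun p hp]
    exact convexOn_log_partitionFn hH hG (QuantumDynamicalSystem.toReal_inv_mem_Icc hp)
  refine ⟨fun α => ⟨Q.continuousOn_pressure t α, Q.antitoneOn_pressure t α⟩,
    fun p hp => ⟨?_, hconv p hp, h0 p hp, h1 p hp,
      fun α hα => nonpos_of_convexOn (hconv p hp) (h0 p hp) (h1 p hp) hα,
      fun α hα => nonneg_of_convexOn (hconv p hp) (h0 p hp) (h1 p hp) hα⟩,
    fun p hp α => Q.pressure_symm p hp t α, fun p hp => ⟨?_, ?_⟩, ?_, ?_,
    fun h p hp α => (Q.pressure_symm p hp t α).trans (Q.pressure_neg_of_isTRI h p hp t _)⟩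
  · rw [hfun p hp]
    exact fun α _ => (analyticAt_partitionFn hH hG _ α).log (partitionFn_pos hH hG _ _)
  · obtain ⟨d, hd, hd'⟩ :=
      exists_hasDerivAt_log_partitionFn_zero hH hG Q.trExp_logRef p⁻¹.toReal
    refine ⟨d, hfun p hp ▸ hd, by rw [hd', Q.ell_eq, expect, Q.exp_logRef], ?_⟩
    rw [← Q.exp_logRef, ← Q.exp_logState, relEntropy_exp hH hG, ← hd', Complex.ofReal_re]
  · obtain ⟨d, hd, hd'⟩ :=
      exists_hasDerivAt_log_partitionFn_one hH hG (Q.trExp_logState t) p⁻¹.toReal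
    refine ⟨d, hfun p hp ▸ hd, by rw [hd', Q.ell_eq, expect, Q.exp_logState], ?_⟩
    rw [← Q.exp_logRef, ← Q.exp_logState, relEntropy_exp hG hH, ← EReal.coe_neg, ← Complex.neg_re,
      mul_sub, tr_sub, neg_sub, ← tr_sub, ← mul_sub, ← hd', Complex.ofReal_re]
  · obtain ⟨d, hd, hd'⟩ := exists_hasDerivAt_deriv_log_partitionFn_zero hH hG Q.trExp_logRef
    have e : (∞ : ℝ≥0∞)⁻¹.toReal = 0 := by simp
    refine ⟨d, by rw [hfun ∞ le_top, e]; exact hd, ?_⟩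
    rw [hd', Q.ell_eq, expect, ← stdCorrelation_exp hH (hG.sub hH), Q.exp_logRef]
  · obtain ⟨d, hd, hd'⟩ := exists_hasDerivAt_deriv_log_partitionFn_half hH hG Q.trExp_logRef
    have e : (2 : ℝ≥0∞)⁻¹.toReal = 1 / 2 := by simp
    refine ⟨d, by rw [hfun 2 one_le_two, e]; exact hd, ?_⟩
    rw [hd', Q.ell_eq, expect, expect, Q.exp_logRef]
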